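/- **Conventions.** Let $U\subseteq\mathbb{C}$ be open and let $\ell$ be a continuous branch of the logarithm on $U$ (so $e^{\ell(z)}=z$ for $z\in U$); put $z^{s}=e^{s\ell(z)}$ and $(z/2)^s=z^s/2^s$ with $2^s=e^{s\ln 2}$. For example, $U=\mathbb{C}\setminus(-\infty,0]$ with the principal logarithm gives the principal branches. For $\nu\in\mathbb{C}$ and $z\in U$ let $$J_\nu(z)=\Big(\frac z2\Big)^{\nu}\sum_{m\ge0}\frac{(-1)^m(z^2/4)^m}{m!\,\Gamma(\nu+m+1)},\qquad I_\nu(z)=\Big(\frac z2\Big)^{\nu}\sum_{m\ge0}\frac{(z^2/4)^m}{m!\,\Gamma(\nu+m+1)},$$ $$Y_\nu(z)=\frac{J_\nu(z)\cos(\nu\pi)-J_{-\nu}(z)}{\sin(\nu\pi)},\qquad K_\nu(z)=\frac{\pi}{2}\,\frac{I_{-\nu}(z)-I_\nu(z)}{\sin(\nu\pi)},$$ where for integer $\nu$ the last two quotients are replaced by their limits in $\nu$, and $1/\Gamma$ is $0$ at the poles of $\Gamma$; let $H^{(1)}_\nu=J_\nu+iY_\nu$ and $H^{(2)}_\nu=J_\nu-iY_\nu$.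 For integers $0\le k\le n$ let $$A_k^n(\nu)=\frac{(2n)!\,(\nu+2k)\prod_{j=0}^{k-1}(2\nu+2j+1)}{2^{2n-k}(2k)!\,(n-k)!\prod_{j=0}^{n}(\nu+k+j)},\qquad B_k^n(\nu)=\frac{(2n+1)!\,(\nu+2k+1)\prod_{j=0}^{k-1}(2\nu+2j+1)}{2^{2n-k}(2k+1)!\,(n-k)!\prod_{j=0}^{n}(\nu+k+j+1)},$$ where the factor $\nu+2k$ (respectively $\nu+2k+1$) is cancelled against the factor $j=k$ of the denominator. For $N\ge1$ let $[N]=\{1,\dots,N\}$ and $-[N]=\{-1,\dots,-N\}$; for $N\in\{0,-1\}$ both are empty. **Statement.** Let $\mathscr{C}_\nu$ be any linear combination of $J_\nu,Y_\nu,H^{(1)}_\nu,H^{(2)}_\nu$ with complex coefficients independent of $\nu$ and $z$. For every $\nu\in\mathbb{C}$ the functions $z^{-\nu}\mathscr{C}_\nu(z)$ and $z^{\nu}\mathscr{C}_\nu(z)$ are holomorphic on $U$, and for all $n\in\{0,1,2,\dots\}$ and $z\in U$, $$\frac{d^{2n}}{dz^{2n}}\Big(\frac{\mathscr{C}_\nu(z)}{z^\nu}\Big)=\sum_{k=0}^n(-1)^{n+k}A_k^n(\nu)\frac{\mathscr{C}_{\nu+2k}(z)}{z^\nu},\qquad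 \nu\in\mathbb{C}\setminus(-[2n-1]),$$ $$\frac{d^{2n+1}}{dz^{2n+1}}\Big(\frac{\mathscr{C}_\nu(z)}{z^\nu}\Big)=\sum_{k=0}^n(-1)^{n+k+1}B_k^n(\nu)\frac{\mathscr{C}_{\nu+2k+1}(z)}{z^\nu},\qquad \nu\in\mathbb{C}\setminus(-[2n]),$$ $$\frac{d^{2n}}{dz^{2n}}\big(z^\nu\mathscr{C}_\nu(z)\big)=\sum_{k=0}^n(-1)^{n+k}A_k^n(-\nu)\,z^\nu\mathscr{C}_{\nu-2k}(z),\qquad \nu\in\mathbb{C}\setminus[2n-1],$$ $$\frac{d^{2n+1}}{dz^{2n+1}}\big(z^\nu\mathscr{C}_\nu(z)\big)=\sum_{k=0}^n(-1)^{n+k}B_k^n(-\nu)\,z^\nu\mathscr{C}_{\nu-2k-1}(z),\qquad \nu\in\mathbb{C}\setminus[2n].$$ Let $\mathscr{L}_\nu$ be any linear combination of $I_\nu$ and $e^{\nu\pi i}K_\nu$ with complex coefficients independent of $\nu$ and $z$. For every $\nu\in\mathbb{C}$ the functions $z^{-\nu}\mathscr{L}_\nu(z)$ and $z^{\nu}\mathscr{L}_\nu(z)$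 are holomorphic on $U$, and for all $n\in\{0,1,2,\dots\}$ and $z\in U$, $$\frac{d^{2n}}{dz^{2n}}\Big(\frac{\mathscr{L}_\nu(z)}{z^\nu}\Big)=\sum_{k=0}^nA_k^n(\nu)\frac{\mathscr{L}_{\nu+2k}(z)}{z^\nu},\qquad \nu\in\mathbb{C}\setminus(-[2n-1]),$$ $$\frac{d^{2n+1}}{dz^{2n+1}}\Big(\frac{\mathscr{L}_\nu(z)}{z^\nu}\Big)=\sum_{k=0}^nB_k^n(\nu)\frac{\mathscr{L}_{\nu+2k+1}(z)}{z^\nu},\qquad \nu\in\mathbb{C}\setminus(-[2n]),$$ $$\frac{d^{2n}}{dz^{2n}}\big(z^\nu\mathscr{L}_\nu(z)\big)=\sum_{k=0}^nA_k^n(-\nu)\,z^\nu\mathscr{L}_{\nu-2k}(z),\qquad \nu\in\mathbb{C}\setminus[2n-1],$$ $$\frac{d^{2n+1}}{dz^{2n+1}}\big(z^\nu\mathscr{L}_\nu(z)\big)=\sum_{k=0}^nB_k^n(-\nu)\,z^\nu\mathscr{L}_{\nu-2k-1}(z),\qquad \nu\in\mathbb{C}\setminus[2n].$$ -/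

import Mathlib

namespace BesselDeriv

/-- The power `z ^ s = exp (s * log z)`, where `ℓ z` is the chosen value of `log z`. -/
noncomputable def bpow (ℓ : ℂ → ℂ) (s z : ℂ) : ℂ := Complex.exp (s * ℓ z)

/-- For the principal logarithm this is the usual complex power. -/
theorem bpow_log (s : ℂ) {z : ℂ} (hz : z ≠ 0) : bpow Complex.log s z = z ^ s := by
  rw [bpow, Complex.cpow_def_of_ne_zero hz, mul_comm]

/-- `J_ν(z) = (z/2)^ν ∑ (-1)^m (z²/4)^m / (m! Γ(ν+m+1))`, with `(z/2)^ν = z^ν / 2^ν` and `z^ν`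
taken for the branch `ℓ` of the logarithm. (At the poles of `Γ` Mathlib sets `Γ = 0`, so that
the quotient is `0`, in agreement with the entire function `1/Γ`.) -/
noncomputable def besselJ (ℓ : ℂ → ℂ) (ν z : ℂ) : ℂ :=
  bpow ℓ ν z / (2 : ℂ) ^ ν *
    ∑' m : ℕ, (-1) ^ m * (z ^ 2 / 4) ^ m / ((m.factorial : ℂ) * Complex.Gamma (ν + m + 1))

/-- `I_ν(z) = (z/2)^ν ∑ (z²/4)^m / (m! Γ(ν+m+1))`. -/
noncomputable def besselI (ℓ : ℂ → ℂ) (ν z : ℂ) : ℂ :=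
  bpow ℓ ν z / (2 : ℂ) ^ ν *
    ∑' m : ℕ, (z ^ 2 / 4) ^ m / ((m.factorial : ℂ) * Complex.Gamma (ν + m + 1))

/-- `(J_ν(z) cos(νπ) - J_{-ν}(z)) / sin(νπ)`, meaningful for non-integer `ν`. -/
noncomputable def quotY (ℓ : ℂ → ℂ) (ν z : ℂ) : ℂ :=
  (besselJ ℓ ν z * Complex.cos (ν * Real.pi) - besselJ ℓ (-ν) z) / Complex.sin (ν * Real.pi)

/-- `(π/2) (I_{-ν}(z) - I_ν(z)) / sin(νπ)`, meaningful for non-integer `ν`. -/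
noncomputable def quotK (ℓ : ℂ → ℂ) (ν z : ℂ) : ℂ :=
  (Real.pi / 2) * (besselI ℓ (-ν) z - besselI ℓ ν z) / Complex.sin (ν * Real.pi)

/-- `Y_ν(z)`; at integers `ν` the quotient is replaced by its limiting value. -/
noncomputable def besselY (ℓ : ℂ → ℂ) (ν z : ℂ) : ℂ :=
  if Complex.sin (ν * Real.pi) = 0 then
    Filter.limUnder (nhdsWithin ν {ν}ᶜ) (fun μ => quotY ℓ μ z)
  else quotY ℓ ν z

/-- `K_ν(z)`; at integers `ν` the quotient is replaced by its limiting value. -/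
noncomputable def besselK (ℓ : ℂ → ℂ) (ν z : ℂ) : ℂ :=
  if Complex.sin (ν * Real.pi) = 0 then
    Filter.limUnder (nhdsWithin ν {ν}ᶜ) (fun μ => quotK ℓ μ z)
  else quotK ℓ ν z

/-- The Hankel function of the first kind, `J_ν + i Y_ν`. -/
noncomputable def hankel1 (ℓ : ℂ → ℂ) (ν z : ℂ) : ℂ :=
  besselJ ℓ ν z + Complex.I * besselY ℓ ν z

/-- The Hankel function of the second kind, `J_ν - i Y_ν`. -/
noncomputable def hankel2 (ℓ : ℂ → ℂ) (ν z : ℂ) : ℂ :=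
  besselJ ℓ ν z - Complex.I * besselY ℓ ν z

/-- A linear combination of `J_ν`, `Y_ν`, `H⁽¹⁾_ν`, `H⁽²⁾_ν` with constant coefficients. -/
noncomputable def combC (ℓ : ℂ → ℂ) (a b c d ν z : ℂ) : ℂ :=
  a * besselJ ℓ ν z + b * besselY ℓ ν z + c * hankel1 ℓ ν z + d * hankel2 ℓ ν z

/-- A linear combination of `I_ν` and `e^{νπi} K_ν` with constant coefficients. -/
noncomputable def combL (ℓ : ℂ → ℂ) (a b ν z : ℂ) : ℂ :=
  a * besselI ℓ ν z + b * (Complex.exp (ν * Real.pi * Complex.I) * besselK ℓ ν z)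

/-- The coefficient `A_k^n(ν)`, `0 ≤ k ≤ n`, with the factor `ν + 2k` of the numerator cancelled
against the factor `j = k` of the product in the denominator (see `coeffA_eq`). -/
noncomputable def coeffA (n k : ℕ) (ν : ℂ) : ℂ :=
  ((2 * n).factorial * ∏ j ∈ Finset.range k, (2 * ν + 2 * j + 1)) /
    (2 ^ (2 * n - k) * (2 * k).factorial * (n - k).factorial *
      ∏ j ∈ (Finset.range (n + 1)).erase k, (ν + k + j))

/-- The coefficient `B_k^n(ν)`, `0 ≤ k ≤ n`, with the factor `ν + 2k + 1` of the numerator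
cancelled against the factor `j = k` of the product in the denominator (see `coeffB_eq`). -/
noncomputable def coeffB (n k : ℕ) (ν : ℂ) : ℂ :=
  ((2 * n + 1).factorial * ∏ j ∈ Finset.range k, (2 * ν + 2 * j + 1)) /
    (2 ^ (2 * n - k) * (2 * k + 1).factorial * (n - k).factorial *
      ∏ j ∈ (Finset.range (n + 1)).erase k, (ν + k + j + 1))

/-- The uncancelled formula for `A_k^n(ν)`. -/
theorem coeffA_eq {n k : ℕ} (hk : k ≤ n) {ν : ℂ} (hν : ν + 2 * k ≠ 0) :
    coeffA n k ν =
      ((2 * n).factorial * (ν + 2 * k) * ∏ j ∈ Finset.range k, (2 * ν + 2 * j + 1)) /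
        (2 ^ (2 * n - k) * (2 * k).factorial * (n - k).factorial *
          ∏ j ∈ Finset.range (n + 1), (ν + k + j)) := by
  rw [coeffA, ← Finset.mul_prod_erase (Finset.range (n + 1)) (fun j : ℕ => ν + k + (j : ℂ))
    (Finset.mem_range.2 (Nat.lt_succ_of_le hk)),
    show ν + (k : ℂ) + (k : ℂ) = ν + 2 * k by ring, ← mul_div_mul_left _ _ hν]
  congr 1 <;> ring

/-- The uncancelled formula for `B_k^n(ν)`. -/
theorem coeffB_eq {n k : ℕ} (hk : k ≤ n) {ν : ℂ} (hν : ν + 2 * k + 1 ≠ 0) :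
    coeffB n k ν =
      ((2 * n + 1).factorial * (ν + 2 * k + 1) * ∏ j ∈ Finset.range k, (2 * ν + 2 * j + 1)) /
        (2 ^ (2 * n - k) * (2 * k + 1).factorial * (n - k).factorial *
          ∏ j ∈ Finset.range (n + 1), (ν + k + j + 1)) := by
  rw [coeffB, ← Finset.mul_prod_erase (Finset.range (n + 1)) (fun j : ℕ => ν + k + (j : ℂ) + 1)
    (Finset.mem_range.2 (Nat.lt_succ_of_le hk)),
    show ν + (k : ℂ) + (k : ℂ) + 1 = ν + 2 * k + 1 by ring, ← mul_div_mul_left _ _ hν]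
  congr 1 <;> ring

end BesselDeriv

/-! Each family in question satisfies, with fixed signs `σ` and `τ`, the two relations F_μ' = σ
F_{μ+1} + (μ/z) F_μ and (2μ/z) F_μ = τ F_{μ-1} - σ F_{μ+1}, recorded in `IsCylinder`. If p' = -(ν/z)
p, as for p = z^{-ν}, the first relation gives (p F_μ)' = σ p F_{μ+1} + ((μ-ν)/z) p F_μ, and the
second trades the factor 1/z for a combination of p F_{μ+1} and p F_{μ-1} with constant coefficients
(`hasDerivAt_weighted'`). Starting from p F_ν and differentiating repeatedly, only orders ν+2k or
ν+2k+1 occur. The stated formulas follow by induction once `coeffA` and `coeffB` are seen to obey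
the resulting Pascal-type recurrences (`coeffB_eq_upA_add`, `coeffA_succ_succ`). The substitution μ
↦ -μ swaps `σ` and `τ`, which turns the formulas for z^{-ν} into those for z^ν.

The relations themselves come from the power series: J has signs (-1, 1) and I has (1, 1).
Multiplication by a function of μ that changes sign under μ ↦ μ+1 flips both signs, so cos(μπ) J_μ
and J_{-μ} agree in sign, and division by sin(μπ) leads back to the signs of J; likewise the factor
e^{μπi} repairs the signs of K. At integers the numerators of Y and K vanish, so the limits are
parameter derivatives divided by π cos(μπ). Differentiating the relations in μ adds only a multiple
of the numerator, which is zero there (`isCylinder_sinQuot`). -/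

namespace BesselDeriv

/-! ### Exponential generating functions of bounded sequences -/

/-- The exponential generating function `∑ w^m / m! * h m`. -/
noncomputable def egf (h : ℕ → ℂ) (w : ℂ) : ℂ := ∑' m : ℕ, w ^ m / (m.factorial : ℂ) * h m

theorem norm_egf_term_le {C R : ℝ} {x w : ℂ} (hx : ‖x‖ ≤ C) (hw : ‖w‖ ≤ R) (m : ℕ) :
    ‖w ^ m / (m.factorial : ℂ) * x‖ ≤ R ^ m / m.factorial * C := by
  have hR : 0 ≤ R := (norm_nonneg w).trans hw
  rw [norm_mul, norm_div, norm_pow, Complex.norm_natCast]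
  gcongr

theorem summable_egf_bound (R C : ℝ) : Summable fun m : ℕ => R ^ m / m.factorial * C :=
  (Real.summable_pow_div_factorial R).mul_right C

theorem summable_egf {h : ℕ → ℂ} {C : ℝ} (hC : ∀ m, ‖h m‖ ≤ C) (w : ℂ) :
    Summable fun m : ℕ => w ^ m / (m.factorial : ℂ) * h m :=
  Summable.of_norm_bounded (summable_egf_bound ‖w‖ C)
    fun m => norm_egf_term_le (hC m) le_rfl m

theorem hasDerivAt_egf_term (h : ℕ → ℂ) (m : ℕ) (w : ℂ) :
    HasDerivAt (fun w : ℂ => w ^ (m + 1) / ((m + 1).factorial : ℂ) * h (m + 1))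
      (w ^ m / (m.factorial : ℂ) * h (m + 1)) w := by
  have := ((hasDerivAt_pow (m + 1) w).div_const ((m + 1).factorial : ℂ)).mul_const (h (m + 1))
  refine this.congr_deriv ?_
  have h1 : (m.factorial : ℂ) ≠ 0 := by exact_mod_cast m.factorial_ne_zero
  have h2 : (m : ℂ) + 1 ≠ 0 := by exact_mod_cast m.succ_ne_zero
  rw [Nat.factorial_succ]
  push_cast
  field_simp

/-- The series is dominated on a ball by a multiple of an exponential series, so it may be
differentiated termwise; this shifts the coefficient sequence. -/
theorem hasDerivAt_egf {h : ℕ → ℂ} {C : ℝ} (hC : ∀ m, ‖h m‖ ≤ C) (w : ℂ) :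
    HasDerivAt (egf h) (egf (fun m => h (m + 1)) w) w := by
  have hw : w ∈ Metric.ball (0 : ℂ) (‖w‖ + 1) := by simp
  have hb : ∀ m : ℕ, ∀ v ∈ Metric.ball (0 : ℂ) (‖w‖ + 1),
      ‖v ^ m / (m.factorial : ℂ) * h m‖ ≤ (‖w‖ + 1) ^ m / m.factorial * C := fun m v hv =>
    norm_egf_term_le (hC m) (by simpa using (mem_ball_zero_iff.1 hv).le) m
  have hd : ∀ m : ℕ, DifferentiableOn ℂ (fun v : ℂ => v ^ m / (m.factorial : ℂ) * h m)
      (Metric.ball (0 : ℂ) (‖w‖ + 1)) := fun m => by fun_prop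
  have hs := Complex.hasSum_deriv_of_summable_norm (summable_egf_bound (‖w‖ + 1) C) hd
    Metric.isOpen_ball hb hw
  have hD := (Complex.differentiableOn_tsum_of_summable_norm (summable_egf_bound (‖w‖ + 1) C) hd
    Metric.isOpen_ball hb).differentiableAt (Metric.isOpen_ball.mem_nhds hw)
  -- The constant term has derivative zero and is dropped, which reindexes the sum of derivatives.
  have := (hasSum_nat_add_iff' 1).2 hs
  simp only [(hasDerivAt_egf_term h _ w).deriv] at this
  have h0 : egf (fun m => h (m + 1)) w = deriv (egf h) w := by
    rw [egf, this.tsum_eq]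
    simp
    rfl
  rw [h0]
  exact hD.hasDerivAt

theorem hasDerivAt_egf_param {h : ℂ → ℕ → ℂ} {C r : ℝ} {μ : ℂ} (hr : 0 < r)
    (hd : ∀ m, Differentiable ℂ fun x => h x m)
    (hC : ∀ m, ∀ x ∈ Metric.ball μ r, ‖h x m‖ ≤ C) (w : ℂ) :
    HasDerivAt (fun x => egf (h x) w) (egf (fun m => deriv (fun x => h x m) μ) w) μ := by
  have hμ : μ ∈ Metric.ball μ r := by simpa using hr
  have hb : ∀ m : ℕ, ∀ x ∈ Metric.ball μ r,
      ‖w ^ m / (m.factorial : ℂ) * h x m‖ ≤ ‖w‖ ^ m / m.factorial * C := fun m x hx =>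
    norm_egf_term_le (hC m x hx) le_rfl m
  have hd' : ∀ m : ℕ, DifferentiableOn ℂ (fun x : ℂ => w ^ m / (m.factorial : ℂ) * h x m)
      (Metric.ball μ r) := fun m => ((hd m).const_mul _).differentiableOn
  have hs := Complex.hasSum_deriv_of_summable_norm (summable_egf_bound ‖w‖ C) hd'
    Metric.isOpen_ball hb hμ
  have hD := (Complex.differentiableOn_tsum_of_summable_norm (summable_egf_bound ‖w‖ C) hd'
    Metric.isOpen_ball hb).differentiableAt (Metric.isOpen_ball.mem_nhds hμ)
  have h0 : egf (fun m => deriv (fun x => h x m) μ) w = deriv (fun x => egf (h x) w) μ := by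
    rw [egf]
    simp only [egf]
    rw [← hs.tsum_eq]
    refine tsum_congr fun m => ?_
    rw [deriv_const_mul _ (hd m μ)]
  rw [h0]
  exact hD.hasDerivAt

/-! ### Bounds for the reciprocal Gamma function -/

theorem norm_inv_Gamma_add_one_le {s : ℂ} (hs : 1 ≤ s.re) :
    ‖(Complex.Gamma (s + 1))⁻¹‖ ≤ ‖(Complex.Gamma s)⁻¹‖ := by
  rw [Complex.one_div_Gamma_eq_self_mul_one_div_Gamma_add_one s, norm_mul]
  exact le_mul_of_one_le_left (norm_nonneg _) (hs.trans (Complex.re_le_norm s))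

theorem differentiable_inv_Gamma_shift (m : ℕ) :
    Differentiable ℂ fun x : ℂ => (Complex.Gamma (x + m + 1))⁻¹ :=
  Complex.differentiable_one_div_Gamma.comp (by fun_prop : Differentiable ℂ fun x : ℂ => x + m + 1)

/-- Once Re s ≥ 1, passing from s to s + 1 divides 1/Γ by a number of modulus at least 1. On the
ball the supremum therefore stops growing after finitely many `m`, and compactness handles those. -/
theorem exists_bound_inv_Gamma (μ : ℂ) (r : ℝ) :
    ∃ C, ∀ m : ℕ, ∀ x ∈ Metric.closedBall μ r, ‖(Complex.Gamma (x + m + 1))⁻¹‖ ≤ C := by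
  have hb : ∀ m : ℕ, ∃ C, ∀ x ∈ Metric.closedBall μ r, ‖(Complex.Gamma (x + m + 1))⁻¹‖ ≤ C :=
    fun m => (isCompact_closedBall μ r).exists_bound_of_continuousOn
      (differentiable_inv_Gamma_shift m).continuous.continuousOn
  choose C hC using hb
  -- From this index on, Re (x + m + 1) ≥ 1 throughout the ball.
  obtain ⟨M, hM⟩ := exists_nat_ge (r - μ.re)
  refine ⟨∑ j ∈ Finset.range (M + 1), |C j|, fun m x hx => ?_⟩
  have hsmall : ∀ m ≤ M, ‖(Complex.Gamma (x + m + 1))⁻¹‖ ≤ ∑ j ∈ Finset.range (M + 1), |C j| :=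
    fun m hm => (hC m x hx).trans ((le_abs_self _).trans
      (Finset.single_le_sum (f := fun j => |C j|) (fun _ _ => abs_nonneg _)
        (Finset.mem_range.2 (Nat.lt_succ_of_le hm))))
  rcases le_total m M with hm | hm
  · exact hsmall m hm
  · induction m, hm using Nat.le_induction with
    | base => exact hsmall M le_rfl
    | succ m hm ih =>
      refine le_trans ?_ ih
      have hre : 1 ≤ (x + m + 1).re := by
        have h1 : |(x - μ).re| ≤ r := (Complex.abs_re_le_norm _).trans (mem_closedBall_iff_norm.1 hx)
        have h2 : (M : ℝ) ≤ m := by exact_mod_cast hm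
        have h3 := (abs_le.1 h1).1
        simp only [Complex.sub_re, Complex.add_re, Complex.natCast_re, Complex.one_re] at h3 ⊢
        linarith
      have := norm_inv_Gamma_add_one_le hre
      push_cast
      rwa [show x + ((m : ℂ) + 1) + 1 = x + m + 1 + 1 by ring]

/-- The entire function `S(μ, w) = ∑ w^m / (m! Γ(μ + m + 1))`. -/
noncomputable def besselS (μ w : ℂ) : ℂ := egf (fun m => (Complex.Gamma (μ + m + 1))⁻¹) w

/-- The derivative of `besselS` in the parameter `μ`. -/
noncomputable def besselSParam (μ w : ℂ) : ℂ :=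
  egf (fun m => deriv (fun x : ℂ => (Complex.Gamma (x + m + 1))⁻¹) μ) w

theorem hasDerivAt_besselS_param (μ w : ℂ) :
    HasDerivAt (fun x => besselS x w) (besselSParam μ w) μ := by
  obtain ⟨C, hC⟩ := exists_bound_inv_Gamma μ 1
  exact hasDerivAt_egf_param one_pos differentiable_inv_Gamma_shift
    (fun m x hx => hC m x (Metric.ball_subset_closedBall hx)) w

theorem hasDerivAt_besselS (μ w : ℂ) : HasDerivAt (besselS μ) (besselS (μ + 1) w) w := by
  obtain ⟨C, hC⟩ := exists_bound_inv_Gamma μ 1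
  have := hasDerivAt_egf (fun m => hC m μ (by simp)) w
  refine this.congr_deriv ?_
  unfold besselS
  congr 1
  funext m
  push_cast
  congr 2
  ring

theorem hasDerivAt_besselSParam (μ w : ℂ) :
    HasDerivAt (besselSParam μ) (besselSParam (μ + 1) w) w := by
  obtain ⟨C, hC⟩ := exists_bound_inv_Gamma μ 1
  -- Cauchy's estimate on the unit circle about `μ` passes the uniform bound on to the derivatives.
  have hb : ∀ m : ℕ, ‖deriv (fun x : ℂ => (Complex.Gamma (x + m + 1))⁻¹) μ‖ ≤ C / 1 := fun m =>
    Complex.norm_deriv_le_of_forall_mem_sphere_norm_le one_pos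
      (differentiable_inv_Gamma_shift m).diffContOnCl
      fun x hx => hC m x (Metric.sphere_subset_closedBall hx)
  have := hasDerivAt_egf hb w
  refine this.congr_deriv ?_
  unfold besselSParam
  congr 1
  funext m
  have h := deriv_comp_add_const (f := fun x : ℂ => (Complex.Gamma (x + m + 1))⁻¹) (a := 1) (x := μ)
  rw [← h]
  congr 1
  funext x
  push_cast
  congr 2
  ring

/-- Here 1/Γ(μ+m) = (μ+m)/Γ(μ+m+1); the summand `μ` gives the first term, and the summand `m`
cancels against m!, shifting the series and producing the factor `w`. -/
theorem besselS_sub_one (μ w : ℂ) :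
    besselS (μ - 1) w = μ * besselS μ w + w * besselS (μ + 1) w := by
  obtain ⟨C, hC⟩ := exists_bound_inv_Gamma μ 1
  obtain ⟨C', hC'⟩ := exists_bound_inv_Gamma (μ + 1) 1
  obtain ⟨D, hD⟩ := exists_bound_inv_Gamma (μ - 1) 1
  have s0 := (summable_egf (fun m => hD m (μ - 1) (by simp)) w)
  have s1 := (summable_egf (fun m => hC m μ (by simp)) w)
  have s2 := (summable_egf (fun m => hC' m (μ + 1) (by simp)) w)
  have e : ∀ m : ℕ, (Complex.Gamma (μ - 1 + m + 1))⁻¹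
      = (μ + m) * (Complex.Gamma (μ + m + 1))⁻¹ := fun m => by
    rw [← Complex.one_div_Gamma_eq_self_mul_one_div_Gamma_add_one]
    congr 2
    ring
  unfold besselS egf
  rw [s0.tsum_eq_zero_add, s1.tsum_eq_zero_add, mul_add, ← tsum_mul_left, ← tsum_mul_left,
    add_assoc (μ * _), ← Summable.tsum_add (((summable_nat_add_iff 1).2 s1).mul_left μ) (s2.mul_left w)]
  congr 1
  · rw [e]
    simp
  · refine tsum_congr fun m => ?_
    rw [e]
    have h1 : (m.factorial : ℂ) ≠ 0 := by exact_mod_cast m.factorial_ne_zero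
    have h2 : (m : ℂ) + 1 ≠ 0 := by exact_mod_cast m.succ_ne_zero
    have h3 : μ + 1 + (m : ℂ) + 1 = μ + ((m + 1 : ℕ) : ℂ) + 1 := by push_cast; ring
    rw [h3, Nat.factorial_succ]
    push_cast
    field_simp
    ring

end BesselDeriv

namespace BesselDeriv

/-! ### Families of solutions of the Bessel recurrences -/

/-- The derivative and three-term relations, with signs `σ` and `τ`, of a family of cylinder
functions on `U`. -/
structure IsCylinder (U : Set ℂ) (σ τ : ℂ) (F : ℂ → ℂ → ℂ) : Prop where
  hasDerivAt : ∀ μ, ∀ z ∈ U, HasDerivAt (F μ) (σ * F (μ + 1) z + μ / z * F μ z) z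
  recurrence : ∀ μ, ∀ z ∈ U, 2 * μ / z * F μ z = τ * F (μ - 1) z - σ * F (μ + 1) z

/-- A cylinder family depending holomorphically on the parameter, with derivative `dF` in the
parameter. -/
structure IsCylinderDeriv (U : Set ℂ) (σ τ : ℂ) (F dF : ℂ → ℂ → ℂ) : Prop
    extends IsCylinder U σ τ F where
  hasDerivAt_param : ∀ μ, ∀ z ∈ U, HasDerivAt (fun x => F x z) (dF μ z) μ
  -- This is `hasDerivAt` differentiated formally in `μ`; having it as a field avoids interchanging
  -- mixed derivatives.
  hasDerivAt_deriv : ∀ μ, ∀ z ∈ U,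
    HasDerivAt (dF μ) (σ * dF (μ + 1) z + μ / z * dF μ z + 1 / z * F μ z) z

variable {U : Set ℂ} {σ τ : ℂ} {F G dF dG : ℂ → ℂ → ℂ}

namespace IsCylinder

theorem add (hF : IsCylinder U σ τ F) (hG : IsCylinder U σ τ G) :
    IsCylinder U σ τ fun μ z => F μ z + G μ z where
  hasDerivAt μ z hz := ((hF.hasDerivAt μ z hz).add (hG.hasDerivAt μ z hz)).congr_deriv (by ring)
  recurrence μ z hz := by linear_combination hF.recurrence μ z hz + hG.recurrence μ z hz

theorem const_mul (c : ℂ) (hF : IsCylinder U σ τ F) : IsCylinder U σ τ fun μ z => c * F μ z where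
  hasDerivAt μ z hz := ((hF.hasDerivAt μ z hz).const_mul c).congr_deriv (by ring)
  recurrence μ z hz := by linear_combination c * hF.recurrence μ z hz

theorem antiperiodic_mul {c : ℂ → ℂ} (hc : ∀ μ, c (μ + 1) = -c μ) (hF : IsCylinder U σ τ F) :
    IsCylinder U (-σ) (-τ) fun μ z => c μ * F μ z where
  hasDerivAt μ z hz := ((hF.hasDerivAt μ z hz).const_mul (c μ)).congr_deriv (by rw [hc]; ring)
  recurrence μ z hz := by
    have h : c (μ - 1) = -c μ := by
      have := hc (μ - 1)
      rw [sub_add_cancel] at this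
      rw [this, neg_neg]
    rw [hc, h]
    linear_combination c μ * hF.recurrence μ z hz

/-- The three-term relation replaces the raised order by the lowered one in the derivative, and
negating the parameter makes lowering into raising. -/
theorem reflect (hF : IsCylinder U σ τ F) : IsCylinder U τ σ fun μ => F (-μ) where
  hasDerivAt μ z hz := (hF.hasDerivAt (-μ) z hz).congr_deriv (by
    have := hF.recurrence (-μ) z hz
    rw [show -(μ + 1) = -μ - 1 by ring]
    linear_combination this)
  recurrence μ z hz := by
    have := hF.recurrence (-μ) z hz
    rw [show -(μ + 1) = -μ - 1 by ring, show -(μ - 1) = -μ + 1 by ring]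
    linear_combination -this

/-- A family that vanishes identically for one integer parameter vanishes for all of them. -/
theorem eq_zero_int (hU : IsOpen U) (hσ : σ ≠ 0) (hτ : τ ≠ 0)
    (hF : IsCylinder U σ τ F) (h0 : ∀ z ∈ U, F 0 z = 0) (n : ℤ) : ∀ z ∈ U, F n z = 0 := by
  -- Vanishing on an open set kills the derivative too, so the derivative relation moves upwards;
  -- the three-term relation then moves downwards.
  have hup : ∀ μ, (∀ z ∈ U, F μ z = 0) → ∀ z ∈ U, F (μ + 1) z = 0 := fun μ h z hz => by
    have h1 : HasDerivAt (F μ) 0 z := (hasDerivAt_const z (0 : ℂ)).congr_of_eventuallyEq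
      (Filter.eventually_of_mem (hU.mem_nhds hz) h)
    have h2 := (hF.hasDerivAt μ z hz).unique h1
    rw [h z hz, mul_zero, add_zero] at h2
    exact (mul_eq_zero.1 h2).resolve_left hσ
  have hdown : ∀ μ, (∀ z ∈ U, F μ z = 0) → ∀ z ∈ U, F (μ - 1) z = 0 := fun μ h z hz => by
    have h1 := hF.recurrence μ z hz
    rw [h z hz, hup μ h z hz, mul_zero, mul_zero, sub_zero] at h1
    exact (mul_eq_zero.1 h1.symm).resolve_left hτ
  induction n using Int.induction_on with
  | zero => simpa using h0
  | succ n ih => simpa using hup _ ih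
  | pred n ih => simpa using hdown _ ih

end IsCylinder

namespace IsCylinderDeriv

theorem recurrence_deriv (hF : IsCylinderDeriv U σ τ F dF) (μ : ℂ) {z : ℂ} (hz : z ∈ U) :
    2 * μ / z * dF μ z + 2 / z * F μ z = τ * dF (μ - 1) z - σ * dF (μ + 1) z := by
  have h1 := ((((hasDerivAt_id μ).const_mul 2).div_const z).mul (hF.hasDerivAt_param μ z hz))
  have h2 := (((hF.hasDerivAt_param (μ - 1) z hz).comp_sub_const μ 1).const_mul τ).sub
    (((hF.hasDerivAt_param (μ + 1) z hz).comp_add_const μ 1).const_mul σ)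
  have h3 : (fun x => 2 * x / z * F x z) = fun x => τ * F (x - 1) z - σ * F (x + 1) z :=
    funext fun x => hF.recurrence x z hz
  have h4 : HasDerivAt (fun x => 2 * x / z * F x z) _ μ := h1
  rw [h3] at h4
  have := h4.unique h2
  simp only [id, mul_one] at this
  linear_combination this

theorem sub (hF : IsCylinderDeriv U σ τ F dF) (hG : IsCylinderDeriv U σ τ G dG) :
    IsCylinderDeriv U σ τ (fun μ z => F μ z - G μ z) (fun μ z => dF μ z - dG μ z) where
  hasDerivAt μ z hz := ((hF.hasDerivAt μ z hz).sub (hG.hasDerivAt μ z hz)).congr_deriv (by ring)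
  recurrence μ z hz := by linear_combination hF.recurrence μ z hz - hG.recurrence μ z hz
  hasDerivAt_param μ z hz := (hF.hasDerivAt_param μ z hz).sub (hG.hasDerivAt_param μ z hz)
  hasDerivAt_deriv μ z hz :=
    ((hF.hasDerivAt_deriv μ z hz).sub (hG.hasDerivAt_deriv μ z hz)).congr_deriv (by ring)

theorem const_mul (c : ℂ) (hF : IsCylinderDeriv U σ τ F dF) :
    IsCylinderDeriv U σ τ (fun μ z => c * F μ z) (fun μ z => c * dF μ z) where
  toIsCylinder := hF.toIsCylinder.const_mul c
  hasDerivAt_param μ z hz := (hF.hasDerivAt_param μ z hz).const_mul c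
  hasDerivAt_deriv μ z hz := ((hF.hasDerivAt_deriv μ z hz).const_mul c).congr_deriv (by ring)

theorem antiperiodic_mul {c dc : ℂ → ℂ} (hc : ∀ μ, c (μ + 1) = -c μ)
    (hd : ∀ μ, HasDerivAt c (dc μ) μ) (hF : IsCylinderDeriv U σ τ F dF) :
    IsCylinderDeriv U (-σ) (-τ) (fun μ z => c μ * F μ z)
      (fun μ z => dc μ * F μ z + c μ * dF μ z) where
  toIsCylinder := hF.toIsCylinder.antiperiodic_mul hc
  hasDerivAt_param μ z hz := (hd μ).mul (hF.hasDerivAt_param μ z hz)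
  hasDerivAt_deriv μ z hz := by
    have h : dc (μ + 1) = -dc μ := by
      have h1 := (hd (μ + 1)).comp_add_const μ 1
      rw [show (fun x => c (x + 1)) = fun x => -c x from funext hc] at h1
      exact h1.unique (hd μ).neg
    refine (((hF.hasDerivAt μ z hz).const_mul (dc μ)).add
      ((hF.hasDerivAt_deriv μ z hz).const_mul (c μ))).congr_deriv ?_
    rw [h, hc]
    ring

theorem reflect (hF : IsCylinderDeriv U σ τ F dF) :
    IsCylinderDeriv U τ σ (fun μ => F (-μ)) (fun μ z => -dF (-μ) z) where
  toIsCylinder := hF.toIsCylinder.reflect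
  hasDerivAt_param μ z hz := by
    have := (hF.hasDerivAt_param (-μ) z hz).comp μ (hasDerivAt_neg μ)
    exact this.congr_deriv (by ring)
  hasDerivAt_deriv μ z hz := (hF.hasDerivAt_deriv (-μ) z hz).neg.congr_deriv (by
    have := hF.recurrence_deriv (-μ) hz
    rw [show -(μ + 1) = -μ - 1 by ring]
    linear_combination -this)

end IsCylinderDeriv

/-- The quotient of `N` by `sin (μπ)`, extended to integers by its limit. -/
noncomputable def sinQuot (N : ℂ → ℂ → ℂ) (μ z : ℂ) : ℂ :=
  if Complex.sin (μ * Real.pi) = 0 then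
    Filter.limUnder (nhdsWithin μ {μ}ᶜ) (fun x => N x z / Complex.sin (x * Real.pi))
  else N μ z / Complex.sin (μ * Real.pi)

theorem sin_add_one_mul_pi (μ : ℂ) :
    Complex.sin ((μ + 1) * Real.pi) = -Complex.sin (μ * Real.pi) := by
  rw [add_mul, one_mul, Complex.sin_add_pi]

theorem cos_add_one_mul_pi (μ : ℂ) :
    Complex.cos ((μ + 1) * Real.pi) = -Complex.cos (μ * Real.pi) := by
  rw [add_mul, one_mul, Complex.cos_add_pi]

theorem sin_mul_pi_eq_zero_iff {μ : ℂ} : Complex.sin (μ * Real.pi) = 0 ↔ ∃ n : ℤ, μ = n := by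
  have : (Real.pi : ℂ) ≠ 0 := Complex.ofReal_ne_zero.2 Real.pi_ne_zero
  rw [Complex.sin_eq_zero_iff]
  exact exists_congr fun n => mul_left_inj' this

theorem hasDerivAt_sin_mul_pi (μ : ℂ) :
    HasDerivAt (fun x : ℂ => Complex.sin (x * Real.pi))
      (Real.pi * Complex.cos (μ * Real.pi)) μ := by
  have := (Complex.hasDerivAt_sin (μ * Real.pi)).comp μ ((hasDerivAt_id μ).mul_const (Real.pi : ℂ))
  exact this.congr_deriv (by ring)

theorem hasDerivAt_cos_mul_pi (μ : ℂ) :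
    HasDerivAt (fun x : ℂ => Complex.cos (x * Real.pi))
      (-Real.pi * Complex.sin (μ * Real.pi)) μ := by
  have := (Complex.hasDerivAt_cos (μ * Real.pi)).comp μ ((hasDerivAt_id μ).mul_const (Real.pi : ℂ))
  exact this.congr_deriv (by ring)

theorem pi_mul_cos_ne_zero {μ : ℂ} (h : Complex.sin (μ * Real.pi) = 0) :
    Real.pi * Complex.cos (μ * Real.pi) ≠ 0 := by
  refine mul_ne_zero (Complex.ofReal_ne_zero.2 Real.pi_ne_zero) fun hc => ?_
  have := Complex.sin_sq_add_cos_sq (μ * Real.pi)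
  simp [h, hc] at this

/-- The zero of sin(xπ) at `μ` is simple, so the limit is that of a quotient of slopes. -/
theorem tendsto_sinQuot (hN : IsCylinderDeriv U σ τ F dF) {μ z : ℂ} (hz : z ∈ U)
    (hs : Complex.sin (μ * Real.pi) = 0) (h0 : F μ z = 0) :
    Filter.Tendsto (fun x => F x z / Complex.sin (x * Real.pi)) (nhdsWithin μ {μ}ᶜ)
      (nhds (dF μ z / (Real.pi * Complex.cos (μ * Real.pi)))) := by
  have h1 := hasDerivAt_iff_tendsto_slope.1 (hN.hasDerivAt_param μ z hz)
  have h2 := hasDerivAt_iff_tendsto_slope.1 (hasDerivAt_sin_mul_pi μ)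
  refine (h1.div h2 (pi_mul_cos_ne_zero hs)).congr' ?_
  filter_upwards [self_mem_nhdsWithin] with x hx
  have hx' : x - μ ≠ 0 := sub_ne_zero.2 hx
  simp only [Pi.div_apply, slope_def_field, h0, hs, sub_zero]
  exact div_div_div_cancel_right₀ hx' _ _

theorem sinQuot_of_eq_zero (hN : IsCylinderDeriv U σ τ F dF) {μ z : ℂ} (hz : z ∈ U)
    (hs : Complex.sin (μ * Real.pi) = 0) (h0 : F μ z = 0) :
    sinQuot F μ z = dF μ z / (Real.pi * Complex.cos (μ * Real.pi)) := by
  rw [sinQuot, if_pos hs]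
  exact (tendsto_sinQuot hN hz hs h0).limUnder_eq

theorem isCylinder_sinQuot (hU : IsOpen U) (hσ : σ ≠ 0) (hτ : τ ≠ 0)
    (hN : IsCylinderDeriv U σ τ F dF) (h0 : ∀ z ∈ U, F 0 z = 0) :
    IsCylinder U (-σ) (-τ) (sinQuot F) := by
  have hint : ∀ μ, Complex.sin (μ * Real.pi) = 0 → ∀ z ∈ U, F μ z = 0 := fun μ hs => by
    obtain ⟨n, rfl⟩ := sin_mul_pi_eq_zero_iff.1 hs
    exact IsCylinder.eq_zero_int hU hσ hτ hN.toIsCylinder h0 n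
  have hq := fun (μ : ℂ) (hs : Complex.sin (μ * Real.pi) = 0) (z : ℂ) (hz : z ∈ U) =>
    sinQuot_of_eq_zero hN hz hs (hint μ hs z hz)
  have hs_sub : ∀ μ : ℂ, Complex.sin ((μ - 1) * Real.pi) = -Complex.sin (μ * Real.pi) := fun μ => by
    rw [sub_mul, one_mul, Complex.sin_sub_pi]
  have hc_sub : ∀ μ : ℂ, Complex.cos ((μ - 1) * Real.pi) = -Complex.cos (μ * Real.pi) := fun μ => by
    rw [sub_mul, one_mul, Complex.cos_sub_pi]
  have key : ∀ μ : ℂ, Complex.sin (μ * Real.pi) ≠ 0 → sinQuot F μ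
      = fun z => F μ z / Complex.sin (μ * Real.pi) := fun μ hs => by
    funext z
    rw [sinQuot, if_neg hs]
  refine ⟨fun μ z hz => ?_, fun μ z hz => ?_⟩
  · by_cases hs : Complex.sin (μ * Real.pi) = 0
    · have hs' : Complex.sin ((μ + 1) * Real.pi) = 0 := by rw [sin_add_one_mul_pi, hs, neg_zero]
      have h1 := ((hN.hasDerivAt_deriv μ z hz).div_const
        (Real.pi * Complex.cos (μ * Real.pi))).congr_of_eventuallyEq
          (Filter.eventually_of_mem (hU.mem_nhds hz) (hq μ hs))
      refine h1.congr_deriv ?_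
      -- The inhomogeneous term (1/z) F_μ from differentiating in `μ` disappears by `hint`.
      rw [hq _ hs z hz, hq _ hs' z hz, hint μ hs z hz, cos_add_one_mul_pi, mul_neg, div_neg]
      ring
    · have hs' : Complex.sin ((μ + 1) * Real.pi) ≠ 0 := by rwa [sin_add_one_mul_pi, neg_ne_zero]
      rw [key μ hs, key _ hs']
      refine ((hN.hasDerivAt μ z hz).div_const _).congr_deriv ?_
      simp only [sin_add_one_mul_pi, div_neg]
      ring
  · by_cases hs : Complex.sin (μ * Real.pi) = 0
    · have hs' : Complex.sin ((μ + 1) * Real.pi) = 0 := by rw [sin_add_one_mul_pi, hs, neg_zero]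
      have hs'' : Complex.sin ((μ - 1) * Real.pi) = 0 := by rw [hs_sub, hs, neg_zero]
      rw [hq _ hs z hz, hq _ hs' z hz, hq _ hs'' z hz, cos_add_one_mul_pi, hc_sub]
      have := hN.recurrence_deriv μ hz
      rw [hint μ hs z hz] at this
      simp only [mul_neg, div_neg]
      linear_combination this / (Real.pi * Complex.cos (μ * Real.pi))
    · have hs' : Complex.sin ((μ + 1) * Real.pi) ≠ 0 := by rwa [sin_add_one_mul_pi, neg_ne_zero]
      have hs'' : Complex.sin ((μ - 1) * Real.pi) ≠ 0 := by rwa [hs_sub, neg_ne_zero]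
      rw [key μ hs, key _ hs', key _ hs'']
      simp only [sin_add_one_mul_pi, hs_sub, div_neg]
      linear_combination hN.recurrence μ z hz / Complex.sin (μ * Real.pi)

end BesselDeriv

namespace BesselDeriv

/-! ### Recurrences for the coefficients -/

theorem prod_range_erase_zero (f : ℕ → ℂ) (n : ℕ) :
    ∏ j ∈ (Finset.range (n + 1)).erase 0, f j = ∏ j ∈ Finset.range n, f (j + 1) := by
  have : (Finset.range (n + 1)).erase 0 = (Finset.range n).map (addRightEmbedding 1) := by
    ext j
    simp only [Finset.mem_erase, Finset.mem_range, Finset.mem_map, addRightEmbedding_apply]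
    constructor
    · rintro ⟨h1, h2⟩
      exact ⟨j - 1, by omega, by omega⟩
    · rintro ⟨i, hi, rfl⟩
      omega
  rw [this, Finset.prod_map]
  rfl

theorem prod_range_erase_last (f : ℕ → ℂ) (n : ℕ) :
    ∏ j ∈ (Finset.range (n + 1)).erase n, f j = ∏ j ∈ Finset.range n, f j := by
  rw [Finset.range_add_one, Finset.erase_insert Finset.notMem_range_self]

theorem prod_shift (x : ℂ) (n : ℕ) :
    ∏ j ∈ Finset.range (n + 1), (x + j) = x * ∏ j ∈ Finset.range n, (x + 1 + j) := by
  rw [Finset.prod_range_succ']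
  simp only [Nat.cast_zero, add_zero, Nat.cast_add, Nat.cast_one]
  rw [mul_comm]
  congr 1
  exact Finset.prod_congr rfl fun j _ => by ring

theorem coeffA_zero_right (n : ℕ) (ν : ℂ) :
    coeffA n 0 ν = (2 * n).factorial /
      (2 ^ (2 * n) * n.factorial * ∏ j ∈ Finset.range n, (ν + 1 + j)) := by
  rw [coeffA, prod_range_erase_zero]
  simp only [Finset.range_zero, Finset.prod_empty, mul_one, mul_zero, Nat.factorial_zero,
    Nat.sub_zero, Nat.cast_zero, Nat.cast_one, add_zero]
  congr 2
  exact Finset.prod_congr rfl fun j _ => by push_cast; ring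

theorem coeffA_self (n : ℕ) (ν : ℂ) :
    coeffA n n ν = (∏ j ∈ Finset.range n, (2 * ν + 2 * j + 1)) /
      (2 ^ n * ∏ j ∈ Finset.range n, (ν + n + j)) := by
  have h : ((2 * n).factorial : ℂ) ≠ 0 := by exact_mod_cast (2 * n).factorial_ne_zero
  rw [coeffA, prod_range_erase_last, show 2 * n - n = n by omega, Nat.sub_self,
    Nat.factorial_zero, Nat.cast_one, mul_one, mul_right_comm,
    mul_comm _ ((2 * n).factorial : ℂ), mul_div_mul_left _ _ h]

theorem coeffB_self (n : ℕ) (ν : ℂ) :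
    coeffB n n ν = (∏ j ∈ Finset.range n, (2 * ν + 2 * j + 1)) /
      (2 ^ n * ∏ j ∈ Finset.range n, (ν + n + 1 + j)) := by
  have h : ((2 * n + 1).factorial : ℂ) ≠ 0 := by exact_mod_cast (2 * n + 1).factorial_ne_zero
  rw [coeffB, prod_range_erase_last, show 2 * n - n = n by omega, Nat.sub_self,
    Nat.factorial_zero, Nat.cast_one, mul_one, mul_right_comm,
    mul_comm _ ((2 * n + 1).factorial : ℂ), mul_div_mul_left _ _ h]
  congr 2
  exact Finset.prod_congr rfl fun j _ => by ring

/-- `coeffA` in the range `0 ≤ k ≤ n = k + d`, with the factor `ν + k` split off. -/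
theorem coeffA_mul {k d : ℕ} {ν : ℂ} (h0 : ν + k ≠ 0) (h : ν + 2 * k ≠ 0) :
    coeffA (k + d) k ν * ((ν + k) / (ν + 2 * k)) =
      ((2 * (k + d)).factorial * ∏ j ∈ Finset.range k, (2 * ν + 2 * j + 1)) /
        (2 ^ (k + 2 * d) * (2 * k).factorial * d.factorial *
          ∏ j ∈ Finset.range (k + d), (ν + k + 1 + j)) := by
  rw [coeffA_eq (Nat.le_add_right k d) h, prod_shift, Nat.add_sub_cancel_left,
    show 2 * (k + d) - k = k + 2 * d by omega]
  -- If the common product vanishes, both sides are divisions by zero and equal 0.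
  by_cases hR : ∏ j ∈ Finset.range (k + d), (ν + k + 1 + j) = 0
  · simp [hR]
  · have h1 : ((2 * k).factorial : ℂ) ≠ 0 := by exact_mod_cast (2 * k).factorial_ne_zero
    have h2 : (d.factorial : ℂ) ≠ 0 := by exact_mod_cast d.factorial_ne_zero
    field_simp

/-- The weight with which `F (ν + 2 k)` contributes to `F (ν + 2 k + 1)` on differentiation. -/
noncomputable def upA (n k : ℕ) (ν : ℂ) : ℂ :=
  ((2 * n).factorial * ∏ j ∈ Finset.range k, (2 * ν + 2 * j + 1)) /
    (2 ^ (2 * n - k) * (2 * k).factorial * (n - k).factorial *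
      ∏ j ∈ Finset.range n, (ν + k + 1 + j))

theorem upA_zero (n : ℕ) (ν : ℂ) : upA n 0 ν = coeffA n 0 ν := by
  rw [coeffA_zero_right, upA]
  simp

/-- For k = 0 and ν = 0 the quotient on the right would be 0/0. Since `upA` has the factor already
cancelled, the value ν = 0 needs no exclusion. -/
theorem upA_eq {n k : ℕ} (hk : k ≤ n) {ν : ℂ} (h0 : ν + k ≠ 0) (h : ν + 2 * k ≠ 0) :
    upA n k ν = coeffA n k ν * ((ν + k) / (ν + 2 * k)) := by
  obtain ⟨d, rfl⟩ := Nat.exists_eq_add_of_le hk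
  rw [coeffA_mul h0 h, upA, Nat.add_sub_cancel_left, show 2 * (k + d) - k = k + 2 * d by omega]

theorem coeffB_self_eq_upA (n : ℕ) (ν : ℂ) : coeffB n n ν = upA n n ν := by
  have h : ((2 * n).factorial : ℂ) ≠ 0 := by exact_mod_cast (2 * n).factorial_ne_zero
  rw [coeffB_self, upA, show 2 * n - n = n by omega, Nat.sub_self,
    Nat.factorial_zero, Nat.cast_one, mul_one, mul_right_comm,
    mul_comm _ ((2 * n).factorial : ℂ), mul_div_mul_left _ _ h]

/-- Order ν+2k+1 is reached from ν+2k by raising and from ν+2k+2 by lowering; the two summands are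
these contributions. -/
theorem coeffB_eq_upA_add {n k : ℕ} (hk : k < n) {ν : ℂ}
    (h : ∀ m : ℕ, 1 ≤ m → m ≤ 2 * n → ν ≠ -(m : ℂ)) :
    coeffB n k ν = upA n k ν + coeffA n (k + 1) ν * ((k + 1) / (ν + 2 * (k + 1))) := by
  have hne : ∀ m : ℕ, 1 ≤ m → m ≤ 2 * n → ν + m ≠ 0 := fun m h1 h2 h3 =>
    h m h1 h2 (eq_neg_of_add_eq_zero_left h3)
  -- Writing n = k + d + 1 removes truncated subtractions. Once the common products and factorials
  -- are split off, a rational identity in ν, k, d remains.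
  obtain ⟨d, rfl⟩ := Nat.exists_eq_add_of_lt hk
  have e1 : ν + 2 * k + 1 ≠ 0 := by
    have := hne (2 * k + 1) (by omega) (by omega)
    push_cast at this
    rwa [← add_assoc] at this
  have e2 : ν + 2 * (k + 1 : ℕ) ≠ 0 := by
    have := hne (2 * (k + 1)) (by omega) (by omega)
    push_cast at this ⊢
    exact this
  rw [coeffA_eq (by omega) e2, coeffB_eq (by omega) e1, upA]
  have s1 : 2 * (k + d + 1) - k = k + 2 * d + 2 := by omega
  have s2 : 2 * (k + d + 1) - (k + 1) = k + 2 * d + 1 := by omega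
  have s3 : k + d + 1 - k = d + 1 := by omega
  have s4 : k + d + 1 - (k + 1) = d := by omega
  have s5 : 2 * (k + 1) = 2 * k + 1 + 1 := by omega
  rw [s1, s2, s3, s4, s5, Finset.prod_range_succ _ k]
  have p1 : ∏ j ∈ Finset.range (k + d + 1 + 1), (ν + k + j + 1)
      = (∏ j ∈ Finset.range (k + d + 1), (ν + k + 1 + j)) * (ν + k + 1 + (k + d + 1 : ℕ)) := by
    rw [← Finset.prod_range_succ]
    exact Finset.prod_congr rfl fun j _ => by ring
  have p2 : ∏ j ∈ Finset.range (k + d + 1 + 1), (ν + (k + 1 : ℕ) + j)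
      = (∏ j ∈ Finset.range (k + d + 1), (ν + k + 1 + j)) * (ν + k + 1 + (k + d + 1 : ℕ)) := by
    rw [← Finset.prod_range_succ]
    exact Finset.prod_congr rfl fun j _ => by push_cast; ring
  rw [p1, p2]
  have hR : ∏ j ∈ Finset.range (k + d + 1), (ν + k + 1 + j) ≠ 0 :=
    Finset.prod_ne_zero_iff.2 fun j hj => by
      have := hne (k + 1 + j) (by omega) (by have := Finset.mem_range.1 hj; omega)
      push_cast at this
      rwa [← add_assoc, ← add_assoc] at this
  have hl : ν + k + 1 + (k + d + 1 : ℕ) ≠ 0 := by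
    have := hne (k + 1 + (k + d + 1)) (by omega) (by omega)
    push_cast at this ⊢
    convert this using 1
    ring
  have hf1 : ((2 * k).factorial : ℂ) ≠ 0 := by exact_mod_cast (2 * k).factorial_ne_zero
  have hf2 : (d.factorial : ℂ) ≠ 0 := by exact_mod_cast d.factorial_ne_zero
  have hf3 : (d : ℂ) + 1 ≠ 0 := by exact_mod_cast d.succ_ne_zero
  have hf4 : (k : ℂ) + 1 ≠ 0 := by exact_mod_cast k.succ_ne_zero
  have hf5 : 2 * (k : ℂ) + 1 ≠ 0 := by exact_mod_cast (2 * k).succ_ne_zero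
  generalize ∏ j ∈ Finset.range (k + d + 1), (ν + k + 1 + (j : ℂ)) = R at *
  generalize ∏ j ∈ Finset.range k, (2 * ν + 2 * (j : ℂ) + 1) = P at *
  rw [Nat.factorial_succ (2 * (k + d + 1)), Nat.factorial_succ (2 * k + 1),
    Nat.factorial_succ (2 * k), Nat.factorial_succ d]
  generalize (2 * (k + d + 1)).factorial = N
  push_cast at *
  have hf6 : 2 * (k : ℂ) + 1 + 1 ≠ 0 := by
    rw [show 2 * (k : ℂ) + 1 + 1 = 2 * (k + 1) by ring]
    exact mul_ne_zero two_ne_zero hf4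
  field_simp
  ring

theorem coeffA_succ_zero {n : ℕ} {ν : ℂ}
    (h : ∀ m : ℕ, 1 ≤ m → m ≤ 2 * n + 1 → ν ≠ -(m : ℂ)) :
    coeffA (n + 1) 0 ν = coeffB n 0 ν * (1 / (2 * (ν + 1))) := by
  have hne : ∀ m : ℕ, 1 ≤ m → m ≤ 2 * n + 1 → ν + m ≠ 0 := fun m h1 h2 h3 =>
    h m h1 h2 (eq_neg_of_add_eq_zero_left h3)
  have h1 : ν + 1 ≠ 0 := by exact_mod_cast hne 1 le_rfl (by omega)
  have h1' : ν + 2 * (0 : ℕ) + 1 ≠ 0 := by simpa using h1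
  rw [coeffA_zero_right, coeffB_eq (Nat.zero_le n) h1']
  have p : ∏ j ∈ Finset.range (n + 1), (ν + (0 : ℕ) + j + 1)
      = ∏ j ∈ Finset.range (n + 1), (ν + 1 + j) :=
    Finset.prod_congr rfl fun j _ => by push_cast; ring
  rw [p]
  have hR : ∏ j ∈ Finset.range (n + 1), (ν + 1 + j) ≠ 0 :=
    Finset.prod_ne_zero_iff.2 fun j hj => by
      have := hne (1 + j) (by omega) (by have := Finset.mem_range.1 hj; omega)
      push_cast at this
      rwa [← add_assoc] at this
  generalize ∏ j ∈ Finset.range (n + 1), (ν + 1 + (j : ℂ)) = R at *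
  have hf2 : (n.factorial : ℂ) ≠ 0 := by exact_mod_cast n.factorial_ne_zero
  have hf3 : (n : ℂ) + 1 ≠ 0 := by exact_mod_cast n.succ_ne_zero
  rw [show 2 * (n + 1) = 2 * n + 1 + 1 by ring, Nat.factorial_succ (2 * n + 1),
    Nat.factorial_succ n]
  generalize (2 * n + 1).factorial = N
  simp only [Finset.range_zero, Finset.prod_empty, mul_zero, Nat.sub_zero,
    Nat.cast_zero, zero_add, Nat.factorial_one]
  push_cast
  field_simp
  ring

theorem coeffA_succ_self {n : ℕ} {ν : ℂ} :
    coeffA (n + 1) (n + 1) ν = coeffB n n ν * ((2 * ν + 2 * n + 1) / (2 * (ν + 2 * n + 1))) := by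
  rw [coeffA_self, coeffB_self, Finset.prod_range_succ, Finset.prod_range_succ _ n]
  have p : ∏ j ∈ Finset.range n, (ν + (n + 1 : ℕ) + j) = ∏ j ∈ Finset.range n, (ν + n + 1 + j) :=
    Finset.prod_congr rfl fun j _ => by push_cast; ring
  rw [p, div_mul_div_comm]
  push_cast
  congr 1
  ring

/-- Order ν+2k+2 is reached from ν+2k+1 by raising and from ν+2k+3 by lowering. The weights are
(μ+ν)/(2μ) and (μ-ν)/(2μ) at these two values of μ. -/
theorem coeffA_succ_succ {n k : ℕ} (hk : k < n) {ν : ℂ}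
    (h : ∀ m : ℕ, 1 ≤ m → m ≤ 2 * n + 1 → ν ≠ -(m : ℂ)) :
    coeffA (n + 1) (k + 1) ν =
      coeffB n k ν * ((2 * ν + 2 * k + 1) / (2 * (ν + 2 * k + 1))) +
        coeffB n (k + 1) ν * ((2 * k + 3) / (2 * (ν + 2 * k + 3))) := by
  have hne : ∀ m : ℕ, 1 ≤ m → m ≤ 2 * n + 1 → ν + m ≠ 0 := fun m h1 h2 h3 =>
    h m h1 h2 (eq_neg_of_add_eq_zero_left h3)
  obtain ⟨d, rfl⟩ := Nat.exists_eq_add_of_lt hk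
  have e1 : ν + 2 * k + 1 ≠ 0 := by
    have := hne (2 * k + 1) (by omega) (by omega)
    push_cast at this
    rwa [← add_assoc] at this
  have e2 : ν + 2 * (k + 1 : ℕ) ≠ 0 := by
    have := hne (2 * (k + 1)) (by omega) (by omega)
    push_cast at this ⊢
    exact this
  have e3 : ν + 2 * (k + 1 : ℕ) + 1 ≠ 0 := by
    have := hne (2 * (k + 1) + 1) (by omega) (by omega)
    push_cast at this ⊢
    rwa [← add_assoc] at this
  rw [coeffA_eq (by omega) e2, coeffB_eq (by omega) e1, coeffB_eq (by omega) e3]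
  have s0 : 2 * (k + d + 1 + 1) - (k + 1) = k + 2 * d + 3 := by omega
  have s1 : 2 * (k + d + 1) - k = k + 2 * d + 2 := by omega
  have s2 : 2 * (k + d + 1) - (k + 1) = k + 2 * d + 1 := by omega
  have s3 : k + d + 1 - k = d + 1 := by omega
  have s4 : k + d + 1 - (k + 1) = d := by omega
  have s5 : 2 * (k + 1) = 2 * k + 1 + 1 := by omega
  have s6 : k + d + 1 + 1 - (k + 1) = d + 1 := by omega
  have s7 : 2 * (k + d + 1 + 1) = 2 * (k + d + 1) + 1 + 1 := by omega
  rw [s0, s1, s2, s3, s4, s6, s5, s7, Finset.prod_range_succ _ k]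
  have hl : ν + k + 1 ≠ 0 := by
    have := hne (k + 1) (by omega) (by omega)
    push_cast at this
    rwa [← add_assoc] at this
  have hl2 : ν + k + 1 + 1 + (k + d + 1 : ℕ) ≠ 0 := by
    have := hne (k + 1 + 1 + (k + d + 1)) (by omega) (by omega)
    push_cast at this ⊢
    convert this using 1
    ring
  have p1 : ∏ j ∈ Finset.range (k + d + 1 + 1), (ν + k + j + 1)
      = (ν + k + 1) * (∏ j ∈ Finset.range (k + d + 1), (ν + k + 1 + 1 + j)) := by
    rw [← prod_shift]
    exact Finset.prod_congr rfl fun j _ => by ring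
  have p2 : ∏ j ∈ Finset.range (k + d + 1 + 1), (ν + (k + 1 : ℕ) + j + 1)
      = (∏ j ∈ Finset.range (k + d + 1), (ν + k + 1 + 1 + j)) *
        (ν + k + 1 + 1 + (k + d + 1 : ℕ)) := by
    rw [← Finset.prod_range_succ]
    exact Finset.prod_congr rfl fun j _ => by push_cast; ring
  have p3 : ∏ j ∈ Finset.range (k + d + 1 + 1 + 1), (ν + (k + 1 : ℕ) + j)
      = (ν + k + 1) * ((∏ j ∈ Finset.range (k + d + 1), (ν + k + 1 + 1 + j)) *
        (ν + k + 1 + 1 + (k + d + 1 : ℕ))) := by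
    rw [← Finset.prod_range_succ, ← prod_shift]
    exact Finset.prod_congr rfl fun j _ => by push_cast; ring
  rw [p1, p2, p3]
  have hR : ∏ j ∈ Finset.range (k + d + 1), (ν + k + 1 + 1 + j) ≠ 0 :=
    Finset.prod_ne_zero_iff.2 fun j hj => by
      have := hne (k + 1 + 1 + j) (by omega) (by have := Finset.mem_range.1 hj; omega)
      push_cast at this
      rwa [← add_assoc, ← add_assoc, ← add_assoc] at this
  have hf1 : ((2 * k).factorial : ℂ) ≠ 0 := by exact_mod_cast (2 * k).factorial_ne_zero
  have hf2 : (d.factorial : ℂ) ≠ 0 := by exact_mod_cast d.factorial_ne_zero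
  have hf3 : (d : ℂ) + 1 ≠ 0 := by exact_mod_cast d.succ_ne_zero
  have hf4 : (k : ℂ) + 1 ≠ 0 := by exact_mod_cast k.succ_ne_zero
  have hf5 : 2 * (k : ℂ) + 1 ≠ 0 := by exact_mod_cast (2 * k).succ_ne_zero
  have hf7 : 2 * (k : ℂ) + 1 + 1 + 1 ≠ 0 := by exact_mod_cast (2 * k + 2).succ_ne_zero
  generalize ∏ j ∈ Finset.range (k + d + 1), (ν + k + 1 + 1 + (j : ℂ)) = R at *
  generalize ∏ j ∈ Finset.range k, (2 * ν + 2 * (j : ℂ) + 1) = P at *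
  rw [Nat.factorial_succ (2 * (k + d + 1) + 1), Nat.factorial_succ (2 * k + 1 + 1),
    Nat.factorial_succ (2 * k + 1), Nat.factorial_succ (2 * k), Nat.factorial_succ d]
  generalize (2 * (k + d + 1) + 1).factorial = N
  push_cast at *
  have hf6 : 2 * (k : ℂ) + 1 + 1 ≠ 0 := by
    rw [show 2 * (k : ℂ) + 1 + 1 = 2 * (k + 1) by ring]
    exact mul_ne_zero two_ne_zero hf4
  have e4 : ν + 2 * k + 3 ≠ 0 := by
    convert e3 using 1
    ring
  have q1 : ν + 2 * (k + 1) + 1 = ν + 2 * k + 3 := by ring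
  rw [q1]
  field_simp
  ring

end BesselDeriv

namespace BesselDeriv

/-! ### Iterated derivatives of a cylinder family -/

variable {U : Set ℂ} {σ τ : ℂ} {F : ℂ → ℂ → ℂ} {p : ℂ → ℂ} {ν : ℂ}

/-- Here `a k` is the raised and `b k` the lowered part of the k-th term. In the odd step the
lowered part of term k + 1 meets the raised part of term k, and b 0 = 0 since nothing drops below
order ν+1. -/
theorem sum_range_regroup {a b c : ℕ → ℂ} {n : ℕ} (hb : b 0 = 0) (hc : c n = a n)
    (h : ∀ k < n, c k = a k + b (k + 1)) :
    ∑ k ∈ Finset.range (n + 1), (a k + b k) = ∑ k ∈ Finset.range (n + 1), c k := by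
  rw [Finset.sum_add_distrib, Finset.sum_range_succ a, Finset.sum_range_succ' b,
    Finset.sum_range_succ c, hb, hc, Finset.sum_congr rfl fun k hk => h k (Finset.mem_range.1 hk),
    Finset.sum_add_distrib]
  ring

/-- The even step: lowering keeps the index k and raising moves it to k + 1, so one new term
appears. -/
theorem sum_range_regroup_succ {a b c : ℕ → ℂ} {n : ℕ} (hb : c 0 = b 0) (hc : c (n + 1) = a n)
    (h : ∀ k < n, c (k + 1) = a k + b (k + 1)) :
    ∑ k ∈ Finset.range (n + 1), (a k + b k) = ∑ k ∈ Finset.range (n + 2), c k := by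
  rw [Finset.sum_add_distrib, Finset.sum_range_succ a, Finset.sum_range_succ' b,
    Finset.sum_range_succ c, Finset.sum_range_succ' c, hb, hc,
    Finset.sum_congr rfl fun k hk => h k (Finset.mem_range.1 hk), Finset.sum_add_distrib]
  ring

theorem IsCylinder.hasDerivAt_weighted (hF : IsCylinder U σ τ F)
    (hp : ∀ z ∈ U, HasDerivAt p (-ν / z * p z) z) (μ : ℂ) {z : ℂ} (hz : z ∈ U) :
    HasDerivAt (fun w => p w * F μ w)
      (σ * (p z * F (μ + 1) z) + (μ - ν) / z * (p z * F μ z)) z :=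
  ((hp z hz).mul (hF.hasDerivAt μ z hz)).congr_deriv (by ring)

theorem IsCylinder.hasDerivAt_weighted' (hF : IsCylinder U σ τ F)
    (hp : ∀ z ∈ U, HasDerivAt p (-ν / z * p z) z) {μ : ℂ} (hμ : μ ≠ 0) {z : ℂ} (hz : z ∈ U) :
    HasDerivAt (fun w => p w * F μ w)
      ((μ + ν) / (2 * μ) * (σ * (p z * F (μ + 1) z)) +
        (μ - ν) / (2 * μ) * (τ * (p z * F (μ - 1) z))) z := by
  refine (hF.hasDerivAt_weighted hp μ hz).congr_deriv ?_
  have h := hF.recurrence μ z hz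
  have e : (μ - ν) / z * (p z * F μ z)
      = (μ - ν) / (2 * μ) * p z * (τ * F (μ - 1) z - σ * F (μ + 1) z) := by
    rw [← h]
    field_simp
  rw [e]
  field_simp
  ring

theorem hasDerivAt_coeffA_term (hF : IsCylinder U σ τ F)
    (hp : ∀ z ∈ U, HasDerivAt p (-ν / z * p z) z) {n k : ℕ} (hk : k ≤ n)
    (h : ∀ m : ℕ, 1 ≤ m → m ≤ 2 * n → ν ≠ -(m : ℂ)) {z : ℂ} (hz : z ∈ U) :
    HasDerivAt (fun w => coeffA n k ν * (p w * F (ν + 2 * k) w))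
      (upA n k ν * (σ * (p z * F (ν + 2 * k + 1) z)) +
        coeffA n k ν * (k / (ν + 2 * k)) * (τ * (p z * F (ν + 2 * k - 1) z))) z := by
  -- For k = 0 the order equals `ν`, so the 1/z term is absent and no division by `ν` is needed;
  -- this keeps ν = 0 admissible.
  rcases Nat.eq_zero_or_pos k with rfl | hpos
  · refine ((hF.hasDerivAt_weighted hp _ hz).const_mul _).congr_deriv ?_
    rw [upA_zero]
    simp
  · have h1 : ν + 2 * k ≠ 0 := fun h3 => h (2 * k) (by omega) (by omega) (by
      push_cast
      exact eq_neg_of_add_eq_zero_left h3)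
    have h2 : ν + k ≠ 0 := fun h3 => h k (by omega) (by omega) (eq_neg_of_add_eq_zero_left h3)
    refine ((hF.hasDerivAt_weighted' hp h1 hz).const_mul _).congr_deriv ?_
    rw [upA_eq hk h2 h1]
    field_simp
    ring

theorem hasDerivAt_coeffB_term (hF : IsCylinder U σ τ F)
    (hp : ∀ z ∈ U, HasDerivAt p (-ν / z * p z) z) {n k : ℕ} (hk : k ≤ n)
    (h : ∀ m : ℕ, 1 ≤ m → m ≤ 2 * n + 1 → ν ≠ -(m : ℂ)) {z : ℂ} (hz : z ∈ U) :
    HasDerivAt (fun w => coeffB n k ν * (p w * F (ν + 2 * k + 1) w))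
      (coeffB n k ν * ((2 * ν + 2 * k + 1) / (2 * (ν + 2 * k + 1))) *
          (σ * (p z * F (ν + 2 * (k + 1 : ℕ)) z)) +
        coeffB n k ν * ((2 * k + 1) / (2 * (ν + 2 * k + 1))) *
          (τ * (p z * F (ν + 2 * k) z))) z := by
  have h1 : ν + 2 * k + 1 ≠ 0 := fun h3 => h (2 * k + 1) (by omega) (by omega) (by
    push_cast
    rw [add_assoc] at h3
    exact eq_neg_of_add_eq_zero_left h3)
  refine ((hF.hasDerivAt_weighted' hp h1 hz).const_mul _).congr_deriv ?_
  rw [show ν + 2 * (k + 1 : ℕ) = ν + 2 * k + 1 + 1 by push_cast; ring,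
    show ν + 2 * (k : ℂ) + 1 - 1 = ν + 2 * k by ring]
  ring

theorem iteratedDeriv_weighted_odd (hU : IsOpen U) (hτ : τ ^ 2 = 1)
    (hF : IsCylinder U σ τ F) (hp : ∀ z ∈ U, HasDerivAt p (-ν / z * p z) z) {n : ℕ}
    (h : ∀ m : ℕ, 1 ≤ m → m ≤ 2 * n → ν ≠ -(m : ℂ))
    (hA : ∀ z ∈ U, iteratedDeriv (2 * n) (fun w => p w * F ν w) z =
      ∑ k ∈ Finset.range (n + 1), (σ * τ) ^ (n + k) * (coeffA n k ν * (p z * F (ν + 2 * k) z)))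
    {z : ℂ} (hz : z ∈ U) :
    iteratedDeriv (2 * n + 1) (fun w => p w * F ν w) z =
      ∑ k ∈ Finset.range (n + 1),
        (σ * τ) ^ (n + k) * σ * (coeffB n k ν * (p z * F (ν + 2 * k + 1) z)) := by
  have hd := (HasDerivAt.fun_sum (u := Finset.range (n + 1)) fun k hk =>
    (hasDerivAt_coeffA_term hF hp (Nat.lt_succ_iff.1 (Finset.mem_range.1 hk)) h hz).const_mul
      ((σ * τ) ^ (n + k))).congr_of_eventuallyEq (Filter.eventually_of_mem (hU.mem_nhds hz) hA)
  rw [iteratedDeriv_succ, hd.deriv]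
  rw [Finset.sum_congr rfl fun k _ => mul_add _ _ _]
  refine sum_range_regroup ?_ ?_ fun k hk => ?_
  · simp
  · rw [coeffB_self_eq_upA]
    ring
  · rw [coeffB_eq_upA_add hk h]
    push_cast
    rw [show ν + 2 * ((k : ℂ) + 1) - 1 = ν + 2 * k + 1 by ring, ← add_assoc n k 1, pow_succ]
    linear_combination (-(σ * τ) ^ (n + k) * σ * coeffA n (k + 1) ν *
      ((k + 1) / (ν + 2 * (k + 1))) * p z * F (ν + 2 * k + 1) z) * hτ

theorem iteratedDeriv_weighted_even_succ (hU : IsOpen U) (hσ : σ ^ 2 = 1) (hτ : τ ^ 2 = 1)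
    (hF : IsCylinder U σ τ F) (hp : ∀ z ∈ U, HasDerivAt p (-ν / z * p z) z) {n : ℕ}
    (h : ∀ m : ℕ, 1 ≤ m → m ≤ 2 * n + 1 → ν ≠ -(m : ℂ))
    (hB : ∀ z ∈ U, iteratedDeriv (2 * n + 1) (fun w => p w * F ν w) z =
      ∑ k ∈ Finset.range (n + 1),
        (σ * τ) ^ (n + k) * σ * (coeffB n k ν * (p z * F (ν + 2 * k + 1) z)))
    {z : ℂ} (hz : z ∈ U) :
    iteratedDeriv (2 * (n + 1)) (fun w => p w * F ν w) z =
      ∑ k ∈ Finset.range (n + 2),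
        (σ * τ) ^ (n + 1 + k) * (coeffA (n + 1) k ν * (p z * F (ν + 2 * k) z)) := by
  have hd := (HasDerivAt.fun_sum (u := Finset.range (n + 1)) fun k hk =>
    (hasDerivAt_coeffB_term hF hp (Nat.lt_succ_iff.1 (Finset.mem_range.1 hk)) h hz).const_mul
      ((σ * τ) ^ (n + k) * σ)).congr_of_eventuallyEq
        (Filter.eventually_of_mem (hU.mem_nhds hz) hB)
  have hε : (σ * τ) ^ 2 = 1 := by rw [mul_pow, hσ, hτ, one_mul]
  rw [show 2 * (n + 1) = 2 * n + 1 + 1 by ring, iteratedDeriv_succ, hd.deriv]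
  rw [Finset.sum_congr rfl fun k _ => mul_add _ _ _]
  refine sum_range_regroup_succ ?_ ?_ fun k hk => ?_
  · rw [coeffA_succ_zero h]
    simp
    ring
  · rw [coeffA_succ_self, show n + 1 + (n + 1) = n + n + 2 by ring, pow_add _ (n + n) 2, hε]
    linear_combination (-(σ * τ) ^ (n + n) * (coeffB n n ν *
      ((2 * ν + 2 * n + 1) / (2 * (ν + 2 * n + 1)))) * p z * F (ν + 2 * (n + 1 : ℕ)) z) * hσ
  · rw [coeffA_succ_succ hk h, show n + 1 + (k + 1) = n + k + 2 by ring, pow_add _ (n + k) 2, hε,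
      ← add_assoc n k 1, pow_succ (σ * τ) (n + k)]
    have e : ν + 2 * ((k + 1 : ℕ) : ℂ) + 1 = ν + 2 * k + 3 := by push_cast; ring
    have e' : 2 * ((k + 1 : ℕ) : ℂ) + 1 = 2 * k + 3 := by push_cast; ring
    rw [e, e']
    generalize coeffB n k ν * ((2 * ν + 2 * k + 1) / (2 * (ν + 2 * k + 1))) = X
    generalize coeffB n (k + 1) ν * ((2 * k + 3) / (2 * (ν + 2 * k + 3))) = Y
    linear_combination (-(σ * τ) ^ (n + k) * X * p z * F (ν + 2 * (k + 1 : ℕ)) z) * hσ -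
      ((σ * τ) ^ (n + k) * Y * p z * F (ν + 2 * (k + 1 : ℕ)) z) * hε

theorem iteratedDeriv_weighted_even (hU : IsOpen U) (hσ : σ ^ 2 = 1) (hτ : τ ^ 2 = 1)
    (hF : IsCylinder U σ τ F) (hp : ∀ z ∈ U, HasDerivAt p (-ν / z * p z) z) (n : ℕ)
    (h : ∀ m : ℕ, 1 ≤ m → m ≤ 2 * n - 1 → ν ≠ -(m : ℂ)) :
    ∀ z ∈ U, iteratedDeriv (2 * n) (fun w => p w * F ν w) z =
      ∑ k ∈ Finset.range (n + 1),
        (σ * τ) ^ (n + k) * (coeffA n k ν * (p z * F (ν + 2 * k) z)) := by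
  induction n with
  | zero => intro z _; simp [coeffA]
  | succ n ih =>
    exact fun z hz => iteratedDeriv_weighted_even_succ hU hσ hτ hF hp
      (fun m h1 h2 => h m h1 (by omega))
      (fun z hz => iteratedDeriv_weighted_odd hU hτ hF hp (fun m h1 h2 => h m h1 (by omega))
        (ih fun m h1 h2 => h m h1 (by omega)) hz) hz

end BesselDeriv

namespace BesselDeriv

/-! ### Bessel functions as cylinder families -/

variable {U : Set ℂ} {ℓ : ℂ → ℂ}

theorem ne_zero_of_exp_log (hexp : ∀ z ∈ U, Complex.exp (ℓ z) = z) {z : ℂ} (hz : z ∈ U) :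
    z ≠ 0 := by
  rw [← hexp z hz]
  exact Complex.exp_ne_zero _

/-- A continuous local right inverse of exp is differentiable, because exp' never vanishes. -/
theorem hasDerivAt_branch (hU : IsOpen U) (hℓ : ContinuousOn ℓ U)
    (hexp : ∀ z ∈ U, Complex.exp (ℓ z) = z) {z : ℂ} (hz : z ∈ U) : HasDerivAt ℓ (1 / z) z := by
  have h := HasDerivAt.of_local_left_inverse (hℓ.continuousAt (hU.mem_nhds hz))
    (Complex.hasDerivAt_exp (ℓ z)) (Complex.exp_ne_zero _)
    (Filter.eventually_of_mem (hU.mem_nhds hz) hexp)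
  rwa [hexp z hz, ← one_div] at h

theorem hasDerivAt_bpow (hU : IsOpen U) (hℓ : ContinuousOn ℓ U)
    (hexp : ∀ z ∈ U, Complex.exp (ℓ z) = z) (s : ℂ) {z : ℂ} (hz : z ∈ U) :
    HasDerivAt (bpow ℓ s) (s / z * bpow ℓ s z) z :=
  ((hasDerivAt_branch hU hℓ hexp hz).const_mul s).cexp.congr_deriv (by rw [bpow]; ring)

/-- The common form of `J` (`κ = -1`) and `I` (`κ = 1`). -/
noncomputable def besselW (ℓ : ℂ → ℂ) (κ μ z : ℂ) : ℂ :=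
  Complex.exp (μ * (ℓ z - Complex.log 2)) * besselS μ (κ * (z ^ 2 / 4))

/-- The derivative of `besselW` in the parameter. -/
noncomputable def besselWParam (ℓ : ℂ → ℂ) (κ μ z : ℂ) : ℂ :=
  Complex.exp (μ * (ℓ z - Complex.log 2)) * ((ℓ z - Complex.log 2) * besselS μ (κ * (z ^ 2 / 4)) +
    besselSParam μ (κ * (z ^ 2 / 4)))

theorem bpow_div_two_cpow (ℓ : ℂ → ℂ) (μ z : ℂ) :
    bpow ℓ μ z / (2 : ℂ) ^ μ = Complex.exp (μ * (ℓ z - Complex.log 2)) := by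
  rw [bpow, Complex.cpow_def_of_ne_zero two_ne_zero, ← Complex.exp_sub]
  congr 1
  ring

theorem besselJ_eq (ℓ : ℂ → ℂ) : besselJ ℓ = besselW ℓ (-1) := by
  funext μ z
  rw [besselJ, besselW, bpow_div_two_cpow, besselS, egf]
  congr 1
  refine tsum_congr fun m => ?_
  rw [mul_pow, div_mul_eq_div_div]
  ring

theorem besselI_eq (ℓ : ℂ → ℂ) : besselI ℓ = besselW ℓ 1 := by
  funext μ z
  rw [besselI, besselW, bpow_div_two_cpow, besselS, egf]
  congr 1
  refine tsum_congr fun m => ?_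
  rw [one_mul, div_mul_eq_div_div]
  ring

theorem exp_sub_log_two (hexp : ∀ z ∈ U, Complex.exp (ℓ z) = z) {z : ℂ} (hz : z ∈ U) :
    Complex.exp (ℓ z - Complex.log 2) = z / 2 := by
  rw [Complex.exp_sub, hexp z hz, Complex.exp_log two_ne_zero]

theorem exp_add_one_mul (hexp : ∀ z ∈ U, Complex.exp (ℓ z) = z) (μ : ℂ) {z : ℂ} (hz : z ∈ U) :
    Complex.exp ((μ + 1) * (ℓ z - Complex.log 2)) =
      z / 2 * Complex.exp (μ * (ℓ z - Complex.log 2)) := by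
  rw [add_mul, one_mul, Complex.exp_add, exp_sub_log_two hexp hz, mul_comm]

theorem exp_sub_one_mul (hexp : ∀ z ∈ U, Complex.exp (ℓ z) = z) (μ : ℂ) {z : ℂ} (hz : z ∈ U) :
    Complex.exp ((μ - 1) * (ℓ z - Complex.log 2)) =
      2 / z * Complex.exp (μ * (ℓ z - Complex.log 2)) := by
  rw [sub_mul, one_mul, Complex.exp_sub, exp_sub_log_two hexp hz, div_eq_mul_inv, inv_div, mul_comm]

/-- The chain rule on κz²/4 yields κ · z/2, and the factor z/2 raises the order of the prefactor
(z/2)^μ; hence `σ` is `κ`. The three-term relation is `besselS_sub_one`. -/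
theorem isCylinderDeriv_besselW (hU : IsOpen U) (hℓ : ContinuousOn ℓ U)
    (hexp : ∀ z ∈ U, Complex.exp (ℓ z) = z) (κ : ℂ) :
    IsCylinderDeriv U κ 1 (besselW ℓ κ) (besselWParam ℓ κ) := by
  have hw : ∀ z : ℂ, HasDerivAt (fun z : ℂ => κ * (z ^ 2 / 4)) (κ * (z / 2)) z := fun z =>
    (((hasDerivAt_pow 2 z).div_const 4).const_mul κ).congr_deriv (by push_cast; ring)
  have hL : ∀ z ∈ U, HasDerivAt (fun z => ℓ z - Complex.log 2) (1 / z) z := fun z hz =>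
    (hasDerivAt_branch hU hℓ hexp hz).sub_const _
  have hE : ∀ μ, ∀ z ∈ U, HasDerivAt (fun z => Complex.exp (μ * (ℓ z - Complex.log 2)))
      (μ / z * Complex.exp (μ * (ℓ z - Complex.log 2))) z := fun μ z hz =>
    ((hL z hz).const_mul μ).cexp.congr_deriv (by ring)
  have hS : ∀ μ z, HasDerivAt (fun z => besselS μ (κ * (z ^ 2 / 4)))
      (besselS (μ + 1) (κ * (z ^ 2 / 4)) * (κ * (z / 2))) z := fun μ z =>
    (hasDerivAt_besselS μ _).comp z (hw z)
  have hS' : ∀ μ z, HasDerivAt (fun z => besselSParam μ (κ * (z ^ 2 / 4)))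
      (besselSParam (μ + 1) (κ * (z ^ 2 / 4)) * (κ * (z / 2))) z := fun μ z =>
    (hasDerivAt_besselSParam μ _).comp z (hw z)
  refine ⟨⟨fun μ z hz => ?_, fun μ z hz => ?_⟩, fun μ z hz => ?_, fun μ z hz => ?_⟩
  · refine ((hE μ z hz).mul (hS μ z)).congr_deriv ?_
    rw [besselW, besselW, exp_add_one_mul hexp μ hz]
    ring
  · have hz0 := ne_zero_of_exp_log hexp hz
    rw [besselW, besselW, besselW, exp_add_one_mul hexp μ hz, exp_sub_one_mul hexp μ hz,
      besselS_sub_one]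
    field_simp
    ring
  · have h1 : HasDerivAt (fun x : ℂ => Complex.exp (x * (ℓ z - Complex.log 2)))
        ((ℓ z - Complex.log 2) * Complex.exp (μ * (ℓ z - Complex.log 2))) μ :=
      ((hasDerivAt_id μ).mul_const (ℓ z - Complex.log 2)).cexp.congr_deriv (by simp [mul_comm])
    refine (h1.mul (hasDerivAt_besselS_param μ _)).congr_deriv ?_
    rw [besselWParam]
    ring
  · refine ((hE μ z hz).mul (((hL z hz).mul (hS μ z)).add (hS' μ z))).congr_deriv ?_
    rw [besselW, besselWParam, besselWParam, exp_add_one_mul hexp μ hz]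
    simp only [Pi.add_apply, Pi.mul_apply]
    ring

theorem quotY_numerator (hU : IsOpen U) (hℓ : ContinuousOn ℓ U)
    (hexp : ∀ z ∈ U, Complex.exp (ℓ z) = z) :
    ∃ dN, IsCylinderDeriv U 1 (-1)
      (fun μ z => Complex.cos (μ * Real.pi) * besselJ ℓ μ z - besselJ ℓ (-μ) z) dN := by
  have hJ := isCylinderDeriv_besselW hU hℓ hexp (-1)
  have h1 := hJ.antiperiodic_mul cos_add_one_mul_pi hasDerivAt_cos_mul_pi
  rw [neg_neg] at h1
  rw [besselJ_eq]
  exact ⟨_, h1.sub hJ.reflect⟩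

theorem besselY_eq (ℓ : ℂ → ℂ) : besselY ℓ =
    sinQuot fun μ z => Complex.cos (μ * Real.pi) * besselJ ℓ μ z - besselJ ℓ (-μ) z := by
  funext μ z
  simp only [besselY, sinQuot, quotY, mul_comm (Complex.cos _)]

theorem besselK_eq (ℓ : ℂ → ℂ) : besselK ℓ =
    sinQuot fun μ z => Real.pi / 2 * (besselI ℓ (-μ) z - besselI ℓ μ z) := rfl

theorem isCylinder_besselJ (hU : IsOpen U) (hℓ : ContinuousOn ℓ U)
    (hexp : ∀ z ∈ U, Complex.exp (ℓ z) = z) : IsCylinder U (-1) 1 (besselJ ℓ) := by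
  rw [besselJ_eq]
  exact (isCylinderDeriv_besselW hU hℓ hexp (-1)).toIsCylinder

theorem isCylinder_besselI (hU : IsOpen U) (hℓ : ContinuousOn ℓ U)
    (hexp : ∀ z ∈ U, Complex.exp (ℓ z) = z) : IsCylinder U 1 1 (besselI ℓ) := by
  rw [besselI_eq]
  exact (isCylinderDeriv_besselW hU hℓ hexp 1).toIsCylinder

theorem isCylinder_besselY (hU : IsOpen U) (hℓ : ContinuousOn ℓ U)
    (hexp : ∀ z ∈ U, Complex.exp (ℓ z) = z) : IsCylinder U (-1) 1 (besselY ℓ) := by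
  obtain ⟨dN, hN⟩ := quotY_numerator hU hℓ hexp
  have := isCylinder_sinQuot hU one_ne_zero (neg_ne_zero.2 one_ne_zero) hN fun z _ => by simp
  rwa [neg_neg, ← besselY_eq] at this

theorem isCylinder_besselK (hU : IsOpen U) (hℓ : ContinuousOn ℓ U)
    (hexp : ∀ z ∈ U, Complex.exp (ℓ z) = z) : IsCylinder U (-1) (-1) (besselK ℓ) := by
  have hI := isCylinderDeriv_besselW hU hℓ hexp 1
  have h := (hI.reflect.sub hI).const_mul (Real.pi / 2)
  rw [← besselI_eq] at h
  rw [besselK_eq]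
  exact isCylinder_sinQuot hU one_ne_zero one_ne_zero h fun z _ => by simp

theorem isCylinder_combC (hU : IsOpen U) (hℓ : ContinuousOn ℓ U)
    (hexp : ∀ z ∈ U, Complex.exp (ℓ z) = z) (a b c d : ℂ) :
    IsCylinder U (-1) 1 (combC ℓ a b c d) := by
  have hJ := isCylinder_besselJ hU hℓ hexp
  have hY := isCylinder_besselY hU hℓ hexp
  have := (hJ.const_mul (a + c + d)).add (hY.const_mul (b + c * Complex.I - d * Complex.I))
  convert this using 1
  funext μ z
  simp only [combC, hankel1, hankel2]
  ring

theorem isCylinder_combL (hU : IsOpen U) (hℓ : ContinuousOn ℓ U)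
    (hexp : ∀ z ∈ U, Complex.exp (ℓ z) = z) (a b : ℂ) : IsCylinder U 1 1 (combL ℓ a b) := by
  have hI := isCylinder_besselI hU hℓ hexp
  have hK := (isCylinder_besselK hU hℓ hexp).antiperiodic_mul
    (c := fun μ => Complex.exp (μ * Real.pi * Complex.I)) fun μ => by
      -- The factor e^{μπi} is antiperiodic, which turns the signs (-1, -1) of K into the signs (1,
      -- 1) of I.
      rw [add_mul, add_mul, one_mul, Complex.exp_add, Complex.exp_pi_mul_I, mul_neg_one]
  rw [neg_neg] at hK
  exact (hI.const_mul a).add (hK.const_mul b)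

/-! ### The formulas for a general cylinder family -/

variable {σ τ : ℂ} {F : ℂ → ℂ → ℂ}

theorem differentiableOn_weighted {p : ℂ → ℂ} {ν : ℂ} (hF : IsCylinder U σ τ F)
    (hp : ∀ z ∈ U, HasDerivAt p (-ν / z * p z) z) (μ : ℂ) :
    DifferentiableOn ℂ (fun w => p w * F μ w) U := fun _ hz =>
  (hF.hasDerivAt_weighted hp μ hz).differentiableAt.differentiableWithinAt

theorem hasDerivAt_bpow_inv (hU : IsOpen U) (hℓ : ContinuousOn ℓ U)
    (hexp : ∀ z ∈ U, Complex.exp (ℓ z) = z) (ν : ℂ) :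
    ∀ z ∈ U, HasDerivAt (fun w => (bpow ℓ ν w)⁻¹) (-ν / z * (bpow ℓ ν z)⁻¹) z := by
  intro z hz
  have h0 : bpow ℓ ν z ≠ 0 := Complex.exp_ne_zero _
  refine ((hasDerivAt_bpow hU hℓ hexp ν hz).inv h0).congr_deriv ?_
  field_simp

theorem hasDerivAt_bpow_neg (hU : IsOpen U) (hℓ : ContinuousOn ℓ U)
    (hexp : ∀ z ∈ U, Complex.exp (ℓ z) = z) (ν : ℂ) :
    ∀ z ∈ U, HasDerivAt (bpow ℓ ν) (-(-ν) / z * bpow ℓ ν z) z := fun z hz => by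
  rw [neg_neg]
  exact hasDerivAt_bpow hU hℓ hexp ν hz

theorem cylinder_derivative_formulas (hU : IsOpen U) (hℓ : ContinuousOn ℓ U)
    (hexp : ∀ z ∈ U, Complex.exp (ℓ z) = z) (hσ : σ ^ 2 = 1) (hτ : τ ^ 2 = 1)
    (hF : IsCylinder U σ τ F) (ν : ℂ) :
    DifferentiableOn ℂ (fun w => F ν w / bpow ℓ ν w) U ∧
    DifferentiableOn ℂ (fun w => bpow ℓ ν w * F ν w) U ∧
    ∀ n : ℕ, ∀ z ∈ U,
      ((∀ m : ℕ, 1 ≤ m → m ≤ 2 * n - 1 → ν ≠ -(m : ℂ)) →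
        iteratedDeriv (2 * n) (fun w => F ν w / bpow ℓ ν w) z =
          ∑ k ∈ Finset.range (n + 1), (σ * τ) ^ (n + k) * coeffA n k ν *
            (F (ν + 2 * k) z / bpow ℓ ν z)) ∧
      ((∀ m : ℕ, 1 ≤ m → m ≤ 2 * n → ν ≠ -(m : ℂ)) →
        iteratedDeriv (2 * n + 1) (fun w => F ν w / bpow ℓ ν w) z =
          ∑ k ∈ Finset.range (n + 1), (σ * τ) ^ (n + k) * σ * coeffB n k ν *
            (F (ν + 2 * k + 1) z / bpow ℓ ν z)) ∧
      ((∀ m : ℕ, 1 ≤ m → m ≤ 2 * n - 1 → ν ≠ (m : ℂ)) →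
        iteratedDeriv (2 * n) (fun w => bpow ℓ ν w * F ν w) z =
          ∑ k ∈ Finset.range (n + 1), (σ * τ) ^ (n + k) * coeffA n k (-ν) *
            (bpow ℓ ν z * F (ν - 2 * k) z)) ∧
      ((∀ m : ℕ, 1 ≤ m → m ≤ 2 * n → ν ≠ (m : ℂ)) →
        iteratedDeriv (2 * n + 1) (fun w => bpow ℓ ν w * F ν w) z =
          ∑ k ∈ Finset.range (n + 1), (σ * τ) ^ (n + k) * τ * coeffB n k (-ν) *
            (bpow ℓ ν z * F (ν - 2 * k - 1) z)) := by
  have hp := hasDerivAt_bpow_inv hU hℓ hexp ν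
  have hq := hasDerivAt_bpow_neg hU hℓ hexp ν
  have hR := hF.reflect
  have e : (fun w => F ν w / bpow ℓ ν w) = fun w => (bpow ℓ ν w)⁻¹ * F ν w :=
    funext fun w => by rw [div_eq_mul_inv, mul_comm]
  -- The product z^ν F_ν is the member of order -ν of the reflected family, with the weight
  -- belonging to -ν.
  have e' : (fun w => bpow ℓ ν w * F ν w) = fun w => bpow ℓ ν w * F (-(-ν)) w := by
    rw [neg_neg]
  have hneg : ∀ m : ℕ, ν ≠ m → -ν ≠ -(m : ℂ) := fun m h => neg_injective.ne h
  rw [e, e']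
  refine ⟨differentiableOn_weighted hF hp ν, differentiableOn_weighted hR hq (-ν),
    fun n z hz => ⟨fun h => ?_, fun h => ?_, fun h => ?_, fun h => ?_⟩⟩
  · rw [iteratedDeriv_weighted_even hU hσ hτ hF hp n h z hz]
    exact Finset.sum_congr rfl fun k _ => by ring
  · rw [iteratedDeriv_weighted_odd hU hτ hF hp h
      (iteratedDeriv_weighted_even hU hσ hτ hF hp n fun m h1 h2 => h m h1 (by omega)) hz]
    exact Finset.sum_congr rfl fun k _ => by ring
  · rw [iteratedDeriv_weighted_even hU hτ hσ hR hq n (fun m h1 h2 => hneg m (h m h1 h2)) z hz]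
    refine Finset.sum_congr rfl fun k _ => ?_
    rw [mul_comm τ σ, show -(-ν + 2 * (k : ℂ)) = ν - 2 * k by ring]
    ring
  · rw [iteratedDeriv_weighted_odd hU hσ hR hq (fun m h1 h2 => hneg m (h m h1 h2))
      (iteratedDeriv_weighted_even hU hτ hσ hR hq n
        fun m h1 h2 => hneg m (h m h1 (by omega))) hz]
    refine Finset.sum_congr rfl fun k _ => ?_
    rw [mul_comm τ σ, show -(-ν + 2 * (k : ℂ) + 1) = ν - 2 * k - 1 by ring]
    ring

end BesselDeriv

/-- `U` is an open set with a continuous branch `ℓ` of the logarithm on it; all powers and all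
Bessel functions are taken for this branch (for `U` the plane slit along `(-∞, 0]` and
`ℓ = Complex.log` they are the principal branches). The functions that are differentiated are
holomorphic on `U`, and their derivatives of every even and odd order are as stated. -/
theorem corollary3p2 (U : Set ℂ) (hU : IsOpen U) (ℓ : ℂ → ℂ) (hℓ : ContinuousOn ℓ U)
    (hexp : ∀ z ∈ U, Complex.exp (ℓ z) = z) :
    (∀ a b c d ν : ℂ,
      DifferentiableOn ℂ
        (fun w => BesselDeriv.combC ℓ a b c d ν w / BesselDeriv.bpow ℓ ν w) U ∧
      DifferentiableOn ℂ
        (fun w => BesselDeriv.bpow ℓ ν w * BesselDeriv.combC ℓ a b c d ν w) U ∧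
      ∀ n : ℕ, ∀ z ∈ U,
        ((∀ m : ℕ, 1 ≤ m → m ≤ 2 * n - 1 → ν ≠ -(m : ℂ)) →
          iteratedDeriv (2 * n)
              (fun w => BesselDeriv.combC ℓ a b c d ν w / BesselDeriv.bpow ℓ ν w) z =
            ∑ k ∈ Finset.range (n + 1), (-1) ^ (n + k) * BesselDeriv.coeffA n k ν *
              (BesselDeriv.combC ℓ a b c d (ν + 2 * k) z / BesselDeriv.bpow ℓ ν z)) ∧
        ((∀ m : ℕ, 1 ≤ m → m ≤ 2 * n → ν ≠ -(m : ℂ)) →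
          iteratedDeriv (2 * n + 1)
              (fun w => BesselDeriv.combC ℓ a b c d ν w / BesselDeriv.bpow ℓ ν w) z =
            ∑ k ∈ Finset.range (n + 1), (-1) ^ (n + k + 1) * BesselDeriv.coeffB n k ν *
              (BesselDeriv.combC ℓ a b c d (ν + 2 * k + 1) z / BesselDeriv.bpow ℓ ν z)) ∧
        ((∀ m : ℕ, 1 ≤ m → m ≤ 2 * n - 1 → ν ≠ (m : ℂ)) →
          iteratedDeriv (2 * n)
              (fun w => BesselDeriv.bpow ℓ ν w * BesselDeriv.combC ℓ a b c d ν w) z =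
            ∑ k ∈ Finset.range (n + 1), (-1) ^ (n + k) * BesselDeriv.coeffA n k (-ν) *
              (BesselDeriv.bpow ℓ ν z * BesselDeriv.combC ℓ a b c d (ν - 2 * k) z)) ∧
        ((∀ m : ℕ, 1 ≤ m → m ≤ 2 * n → ν ≠ (m : ℂ)) →
          iteratedDeriv (2 * n + 1)
              (fun w => BesselDeriv.bpow ℓ ν w * BesselDeriv.combC ℓ a b c d ν w) z =
            ∑ k ∈ Finset.range (n + 1), (-1) ^ (n + k) * BesselDeriv.coeffB n k (-ν) *
              (BesselDeriv.bpow ℓ ν z * BesselDeriv.combC ℓ a b c d (ν - 2 * k - 1) z))) ∧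
    (∀ a b ν : ℂ,
      DifferentiableOn ℂ (fun w => BesselDeriv.combL ℓ a b ν w / BesselDeriv.bpow ℓ ν w) U ∧
      DifferentiableOn ℂ (fun w => BesselDeriv.bpow ℓ ν w * BesselDeriv.combL ℓ a b ν w) U ∧
      ∀ n : ℕ, ∀ z ∈ U,
        ((∀ m : ℕ, 1 ≤ m → m ≤ 2 * n - 1 → ν ≠ -(m : ℂ)) →
          iteratedDeriv (2 * n)
              (fun w => BesselDeriv.combL ℓ a b ν w / BesselDeriv.bpow ℓ ν w) z =
            ∑ k ∈ Finset.range (n + 1), BesselDeriv.coeffA n k ν *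
              (BesselDeriv.combL ℓ a b (ν + 2 * k) z / BesselDeriv.bpow ℓ ν z)) ∧
        ((∀ m : ℕ, 1 ≤ m → m ≤ 2 * n → ν ≠ -(m : ℂ)) →
          iteratedDeriv (2 * n + 1)
              (fun w => BesselDeriv.combL ℓ a b ν w / BesselDeriv.bpow ℓ ν w) z =
            ∑ k ∈ Finset.range (n + 1), BesselDeriv.coeffB n k ν *
              (BesselDeriv.combL ℓ a b (ν + 2 * k + 1) z / BesselDeriv.bpow ℓ ν z)) ∧
        ((∀ m : ℕ, 1 ≤ m → m ≤ 2 * n - 1 → ν ≠ (m : ℂ)) →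
          iteratedDeriv (2 * n)
              (fun w => BesselDeriv.bpow ℓ ν w * BesselDeriv.combL ℓ a b ν w) z =
            ∑ k ∈ Finset.range (n + 1), BesselDeriv.coeffA n k (-ν) *
              (BesselDeriv.bpow ℓ ν z * BesselDeriv.combL ℓ a b (ν - 2 * k) z)) ∧
        ((∀ m : ℕ, 1 ≤ m → m ≤ 2 * n → ν ≠ (m : ℂ)) →
          iteratedDeriv (2 * n + 1)
              (fun w => BesselDeriv.bpow ℓ ν w * BesselDeriv.combL ℓ a b ν w) z =
            ∑ k ∈ Finset.range (n + 1), BesselDeriv.coeffB n k (-ν) *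
              (BesselDeriv.bpow ℓ ν z * BesselDeriv.combL ℓ a b (ν - 2 * k - 1) z))) := by
  refine ⟨fun a b c d ν => ?_, fun a b ν => ?_⟩
  · have h := BesselDeriv.cylinder_derivative_formulas hU hℓ hexp (by norm_num) (by norm_num)
      (BesselDeriv.isCylinder_combC hU hℓ hexp a b c d) ν
    simpa only [mul_one, pow_succ] using h
  · have h := BesselDeriv.cylinder_derivative_formulas hU hℓ hexp (by norm_num) (by norm_num)
      (BesselDeriv.isCylinder_combL hU hℓ hexp a b) ν
    simpa only [mul_one, one_pow, one_mul] using h
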